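/- Let $N\ge 2$, $0<R<1$ and $\sigma_c,\sigma_s>0$, and let $B_r\subset\mathbb{R}^N$ be the open ball of radius $r$ centered at the origin. For sets $D\subset\Omega\subset\mathbb{R}^N$ with $\Omega$ bounded and open and $D$ open, put $\sigma=\sigma_c$ on $D$ and $\sigma=\sigma_s$ on $\Omega\setminus D$, let $u\in H^1_0(\Omega)$ be the weak solution of $-\operatorname{div}(\sigma\nabla u)=1$ in $\Omega$, $u=0$ on $\partial\Omega$, that is, $\int_\Omega\sigma\nabla u\cdot\nabla\psi=\int_\Omega\psi$ for all $\psi\in H^1_0(\Omega)$, and define the two-phase torsional rigidity $E(D,\Omega)=\int_\Omega\sigma|\nabla u|^2=\int_\Omega u$. Let $C^{2,\infty}(\mathbb{R}^N,\mathbb{R}^N)$ be the space of $C^2$ vector fields that are bounded together with their first and second derivatives, with the norm of $W^{2,\infty}$. Let $\Phi:[0,1)\to C^{2,\infty}(\mathbb{R}^N,\mathbb{R}^N)$ be differentiable at $0$ with $\Phi(0)=0$ (for instance $\Phi$ of class $C^2$ with $\Phi(0)=0$), and write $\omega_t=(\mathrm{Id}+\Phi(t))(\omega)$. Suppose that, for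 all sufficiently small $t\ge 0$, $$\operatorname{Vol}((B_R)_t)=\operatorname{Vol}(B_R)\quad\text{and}\quad \operatorname{Vol}((B_1)_t)=\operatorname{Vol}(B_1).$$ Then $E((B_R)_t,(B_1)_t)$ is well defined for all sufficiently small $t\ge0$ (the boundary value problem has exactly one weak solution), the function $t\mapsto E((B_R)_t,(B_1)_t)$ is (right) differentiable at $t=0$, and $$E'(B_R,B_1)(\Phi)=\frac{d}{dt}\Big|_{t=0}E\big((B_R)_t,(B_1)_t\big)=0 .$$ In other words, the pair of concentric balls $(B_R,B_1)$ is a critical shape for $E$ under the fixed volume constraint. -/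

import Mathlib

open MeasureTheory Filter Topology

noncomputable section

/-- The Euclidean space `ℝ^N`. -/
abbrev Space (N : ℕ) : Type := EuclideanSpace ℝ (Fin N)

/-! ### The space of perturbation fields -/

/-- The supremum norm of a bounded map. -/
def supNorm {V W : Type} [NormedAddCommGroup W] (F : V → W) : ℝ := ⨆ x, ‖F x‖

theorem le_supNorm {V W : Type} [NormedAddCommGroup W] {F : V → W} (hF : ∃ C, ∀ x, ‖F x‖ ≤ C)
    (x : V) : ‖F x‖ ≤ supNorm F := by
  obtain ⟨C, hC⟩ := hF
  exact le_ciSup (f := fun y => ‖F y‖) ⟨C, by rintro _ ⟨y, rfl⟩; exact hC y⟩ x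

theorem supNorm_add_le {V W : Type} [Nonempty V] [NormedAddCommGroup W] {F G : V → W}
    (hF : ∃ C, ∀ x, ‖F x‖ ≤ C) (hG : ∃ C, ∀ x, ‖G x‖ ≤ C) :
    supNorm (F + G) ≤ supNorm F + supNorm G :=
  ciSup_le fun x => norm_add_le_of_le (le_supNorm hF x) (le_supNorm hG x)

theorem supNorm_smul {V W : Type} [NormedAddCommGroup W] [NormedSpace ℝ W] (c : ℝ) (F : V → W) :
    supNorm (c • F) = ‖c‖ * supNorm F := by
  unfold supNorm
  rw [Real.mul_iSup_of_nonneg (norm_nonneg c)]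
  exact iSup_congr fun x => norm_smul c (F x)

/-- The vector fields on `V` of class `C²` that are bounded together with their first and second
derivatives, as a linear subspace of all vector fields. -/
def boundedC2Fields (V : Type) [NormedAddCommGroup V] [NormedSpace ℝ V] : Submodule ℝ (V → V) where
  carrier := {f | ContDiff ℝ 2 f ∧ (∃ C, ∀ x, ‖f x‖ ≤ C) ∧ (∃ C, ∀ x, ‖fderiv ℝ f x‖ ≤ C) ∧
    ∃ C, ∀ x, ‖fderiv ℝ (fderiv ℝ f) x‖ ≤ C}
  zero_mem' := by
    refine ⟨contDiff_const, ⟨0, fun x => by simp⟩, ⟨0, fun x => by simp⟩, ⟨0, fun x => ?_⟩⟩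
    have h0 : fderiv ℝ (0 : V → V) = 0 := by
      funext y
      exact fderiv_const_apply 0
    have h1 : fderiv ℝ (0 : V → V →L[ℝ] V) = 0 := by
      funext y
      exact fderiv_const_apply 0
    change ‖fderiv ℝ (fderiv ℝ (0 : V → V)) x‖ ≤ 0
    rw [h0, h1]
    exact norm_zero.le
  add_mem' := by
    rintro f g ⟨hf, ⟨A, hA⟩, ⟨A', hA'⟩, ⟨A'', hA''⟩⟩ ⟨hg, ⟨B, hB⟩, ⟨B', hB'⟩, ⟨B'', hB''⟩⟩
    have h1 : fderiv ℝ (f + g) = fderiv ℝ f + fderiv ℝ g := by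
      funext x
      exact fderiv_add (hf.differentiable (by norm_num) x) (hg.differentiable (by norm_num) x)
    have hf1 : ContDiff ℝ 1 (fderiv ℝ f) := hf.fderiv_right (by norm_num)
    have hg1 : ContDiff ℝ 1 (fderiv ℝ g) := hg.fderiv_right (by norm_num)
    refine ⟨hf.add hg, ⟨A + B, fun x => norm_add_le_of_le (hA x) (hB x)⟩, ⟨A' + B', fun x => ?_⟩,
      ⟨A'' + B'', fun x => ?_⟩⟩
    · rw [h1]
      exact norm_add_le_of_le (hA' x) (hB' x)
    · rw [h1, fderiv_add (hf1.differentiable (by norm_num) x) (hg1.differentiable (by norm_num) x)]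
      exact (norm_add_le _ _).trans (add_le_add (hA'' x) (hB'' x))
  smul_mem' := by
    rintro c f ⟨hf, ⟨A, hA⟩, ⟨A', hA'⟩, ⟨A'', hA''⟩⟩
    have h1 : fderiv ℝ (c • f) = c • fderiv ℝ f := by
      funext x
      exact fderiv_const_smul (hf.differentiable (by norm_num) x) c
    have hf1 : ContDiff ℝ 1 (fderiv ℝ f) := hf.fderiv_right (by norm_num)
    refine ⟨hf.const_smul c, ⟨‖c‖ * A, fun x => ?_⟩, ⟨‖c‖ * A', fun x => ?_⟩,
      ⟨‖c‖ * A'', fun x => ?_⟩⟩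
    · exact (norm_smul_le _ _).trans (mul_le_mul_of_nonneg_left (hA x) (norm_nonneg c))
    · rw [h1]
      exact (norm_smul_le _ _).trans (mul_le_mul_of_nonneg_left (hA' x) (norm_nonneg c))
    · rw [h1, fderiv_const_smul (hf1.differentiable (by norm_num) x)]
      exact (norm_smul_le _ _).trans (mul_le_mul_of_nonneg_left (hA'' x) (norm_nonneg c))

/-- The normed space `C^{2,∞}(V, V) = C² ∩ W^{2,∞}` (below, `V = ℝ^N`). It is a separate type because its topology
is the one of the norm defined below, not the one of pointwise convergence. -/
def C2Bounded (V : Type) [NormedAddCommGroup V] [NormedSpace ℝ V] : Type := ↥(boundedC2Fields V)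

namespace C2Bounded

variable {V : Type} [NormedAddCommGroup V] [NormedSpace ℝ V]

instance : AddCommGroup (C2Bounded V) := inferInstanceAs (AddCommGroup ↥(boundedC2Fields V))

instance : Module ℝ (C2Bounded V) := inferInstanceAs (Module ℝ ↥(boundedC2Fields V))

instance : CoeFun (C2Bounded V) (fun _ => V → V) := ⟨fun f => Subtype.val f⟩

theorem add_fun (f g : C2Bounded V) : (⇑(f + g) : V → V) = ⇑f + ⇑g := rfl

theorem smul_fun (c : ℝ) (f : C2Bounded V) : (⇑(c • f) : V → V) = c • ⇑f := rfl

theorem contDiff (f : C2Bounded V) : ContDiff ℝ 2 f := f.2.1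

theorem contDiff_fderiv (f : C2Bounded V) : ContDiff ℝ 1 (fderiv ℝ f) :=
  f.contDiff.fderiv_right (by norm_num)

theorem fderiv_add_fun (f g : C2Bounded V) :
    fderiv ℝ ⇑(f + g) = fderiv ℝ ⇑f + fderiv ℝ ⇑g := by
  funext x
  exact fderiv_add (f.contDiff.differentiable (by norm_num) x)
    (g.contDiff.differentiable (by norm_num) x)

theorem fderiv_smul_fun (c : ℝ) (f : C2Bounded V) :
    fderiv ℝ ⇑(c • f) = c • fderiv ℝ ⇑f := by
  funext x
  exact fderiv_const_smul (f.contDiff.differentiable (by norm_num) x) c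

theorem fderiv_fderiv_add_fun (f g : C2Bounded V) : fderiv ℝ (fderiv ℝ ⇑(f + g)) =
    fderiv ℝ (fderiv ℝ ⇑f) + fderiv ℝ (fderiv ℝ ⇑g) := by
  rw [fderiv_add_fun]
  funext x
  exact fderiv_add (f.contDiff_fderiv.differentiable (by norm_num) x)
    (g.contDiff_fderiv.differentiable (by norm_num) x)

theorem fderiv_fderiv_smul_fun (c : ℝ) (f : C2Bounded V) :
    fderiv ℝ (fderiv ℝ ⇑(c • f)) = c • fderiv ℝ (fderiv ℝ ⇑f) := by
  rw [fderiv_smul_fun]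
  funext x
  exact fderiv_const_smul (f.contDiff_fderiv.differentiable (by norm_num) x) c

/-- The norm of `f` is the largest of the supremum norms of `f`, `Df` and `D²f`. -/
instance : Norm (C2Bounded V) :=
  ⟨fun f => max (supNorm ⇑f) (max (supNorm (fderiv ℝ ⇑f)) (supNorm (fderiv ℝ (fderiv ℝ ⇑f))))⟩

theorem norm_def (f : C2Bounded V) : ‖f‖ =
    max (supNorm ⇑f) (max (supNorm (fderiv ℝ ⇑f)) (supNorm (fderiv ℝ (fderiv ℝ ⇑f)))) := rfl

theorem norm_smul_eq (c : ℝ) (f : C2Bounded V) : ‖c • f‖ = ‖c‖ * ‖f‖ := by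
  rw [norm_def, norm_def, smul_fun, ← smul_fun, fderiv_fderiv_smul_fun, fderiv_smul_fun, smul_fun,
    supNorm_smul, supNorm_smul, supNorm_smul, mul_max_of_nonneg _ _ (norm_nonneg c),
    mul_max_of_nonneg _ _ (norm_nonneg c)]

theorem norm_add_le' (f g : C2Bounded V) : ‖f + g‖ ≤ ‖f‖ + ‖g‖ := by
  rw [norm_def (f + g), fderiv_fderiv_add_fun, fderiv_add_fun, add_fun]
  refine max_le ?_ (max_le ?_ ?_)
  · exact (supNorm_add_le f.2.2.1 g.2.2.1).trans
      (add_le_add (le_max_left _ _) (le_max_left _ _))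
  · exact (supNorm_add_le f.2.2.2.1 g.2.2.2.1).trans
      (add_le_add ((le_max_left _ _).trans (le_max_right _ _))
        ((le_max_left _ _).trans (le_max_right _ _)))
  · exact (supNorm_add_le f.2.2.2.2 g.2.2.2.2).trans
      (add_le_add ((le_max_right _ _).trans (le_max_right _ _))
        ((le_max_right _ _).trans (le_max_right _ _)))

instance : NormedAddCommGroup (C2Bounded V) :=
  AddGroupNorm.toNormedAddCommGroup
    { toFun := fun f => ‖f‖
      map_zero' := by
        have h := norm_smul_eq (0 : ℝ) (0 : C2Bounded V)
        rwa [zero_smul, norm_zero, zero_mul] at h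
      add_le' := norm_add_le'
      neg' := fun f => by
        have h := norm_smul_eq (-1 : ℝ) f
        rwa [neg_smul, one_smul, norm_neg, norm_one, one_mul] at h
      eq_zero_of_map_eq_zero' := fun f hf => by
        refine Subtype.ext (funext fun x => ?_)
        have h : ‖f x‖ ≤ ‖f‖ := (le_supNorm f.2.2.1 x).trans (le_max_left _ _)
        exact norm_le_zero_iff.mp (h.trans hf.le) }

instance : NormedSpace ℝ (C2Bounded V) := ⟨fun c f => (norm_smul_eq c f).le⟩

end C2Bounded

/-! ### Perturbations of domains -/

/-- The perturbed set `ω_t = (Id + Φ(t))(ω)`. -/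
def perturbed {N : ℕ} (Φ : ℝ → C2Bounded (Space N)) (ω : Set (Space N)) (t : ℝ) : Set (Space N) :=
  (fun x => x + Φ t x) '' ω

/-- `Φ : [0,1) → C^{2,∞}(ℝ^N, ℝ^N)` is differentiable at `0` and `Φ(0) = 0`. The values of `Φ`
outside `[0,1)` are irrelevant. -/
def IsPerturbation {N : ℕ} (Φ : ℝ → C2Bounded (Space N)) : Prop :=
  Φ 0 = 0 ∧ DifferentiableWithinAt ℝ Φ (Set.Ico 0 1) 0

/-- `Vol(ω_t) = Vol(ω)` for all small `t ≥ 0`. -/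
def PreservesVolume {N : ℕ} (Φ : ℝ → C2Bounded (Space N)) (ω : Set (Space N)) : Prop :=
  ∀ᶠ t in 𝓝[≥] (0 : ℝ), volume (perturbed Φ ω t) = volume ω

/-- The shape derivative `J'(D, Ω)(Φ)` of a functional of pairs of domains exists and equals `l`,
that is, `j(t) = J(D_t, Ω_t)` has the (one-sided) derivative `l` at `t = 0`. -/
def HasShapeDeriv {N : ℕ} (J : Set (Space N) → Set (Space N) → ℝ) (D Ω : Set (Space N))
    (Φ : ℝ → C2Bounded (Space N)) (l : ℝ) : Prop :=
  HasDerivWithinAt (fun t => J (perturbed Φ D t) (perturbed Φ Ω t)) l (Set.Ico 0 1) 0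

/-! ### Sobolev spaces, the two-phase problem and the torsional rigidity -/

/-- Smooth functions with compact support contained in `Ω`. -/
def IsTestFunction {N : ℕ} (Ω : Set (Space N)) (φ : Space N → ℝ) : Prop :=
  ContDiff ℝ (⊤ : ℕ∞) φ ∧ HasCompactSupport φ ∧ tsupport φ ⊆ Ω

/-- `u ∈ H¹(Ω)`, with weak gradient `g`. -/
structure MemH1 {N : ℕ} (Ω : Set (Space N)) (u : Space N → ℝ) (g : Space N → Space N) : Prop where
  memLp : MemLp u 2 (volume.restrict Ω)
  memLp_grad : MemLp g 2 (volume.restrict Ω)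
  weak_grad : ∀ φ, IsTestFunction Ω φ → ∀ v : Space N,
    ∫ x in Ω, u x * fderiv ℝ φ x v = -∫ x in Ω, inner ℝ (g x) v * φ x

/-- `u ∈ H¹₀(Ω)`, with weak gradient `g`: the closure in `H¹(Ω)` of the test functions. -/
structure MemH10 {N : ℕ} (Ω : Set (Space N)) (u : Space N → ℝ) (g : Space N → Space N) : Prop
    extends MemH1 Ω u g where
  approx : ∃ φ : ℕ → Space N → ℝ, (∀ n, IsTestFunction Ω (φ n)) ∧
    Tendsto (fun n => eLpNorm (φ n - u) 2 (volume.restrict Ω)) atTop (𝓝 0) ∧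
    Tendsto (fun n => eLpNorm (gradient (φ n) - g) 2 (volume.restrict Ω)) atTop (𝓝 0)

open Classical in
/-- The coefficient `σ`: `σc` in the core `D`, `σs` in the shell `Ω \ D`. -/
def twoPhase {N : ℕ} (σc σs : ℝ) (D : Set (Space N)) (x : Space N) : ℝ :=
  if x ∈ D then σc else σs

/-- `u ∈ H¹₀(Ω)`, with weak gradient `g`, is a weak solution of `-div(σ∇u) = 1` in `Ω`, `u = 0`
on `∂Ω`. -/
structure IsWeakSolution {N : ℕ} (σc σs : ℝ) (D Ω : Set (Space N)) (u : Space N → ℝ)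
    (g : Space N → Space N) : Prop where
  mem : MemH10 Ω u g
  weak : ∀ (ψ : Space N → ℝ) (ζ : Space N → Space N), MemH10 Ω ψ ζ →
    ∫ x in Ω, twoPhase σc σs D x * inner ℝ (g x) (ζ x) = ∫ x in Ω, ψ x

/-- The two-phase problem on `(D, Ω)` has exactly one solution, up to equality almost everywhere. -/
def WellPosed {N : ℕ} (σc σs : ℝ) (D Ω : Set (Space N)) : Prop :=
  ∃ (u : Space N → ℝ) (g : Space N → Space N), IsWeakSolution σc σs D Ω u g ∧
    ∀ u' g', IsWeakSolution σc σs D Ω u' g' →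
      u' =ᵐ[volume.restrict Ω] u ∧ g' =ᵐ[volume.restrict Ω] g

open Classical in
/-- The two-phase torsional rigidity `E(D, Ω) = ∫_Ω σ|∇u|²`, where `u` is the solution of the
two-phase problem (and `0` by convention when there is no solution). -/
def torsionalRigidity {N : ℕ} (σc σs : ℝ) (D Ω : Set (Space N)) : ℝ :=
  if h : ∃ p : (Space N → ℝ) × (Space N → Space N), IsWeakSolution σc σs D Ω p.1 p.2 then
    ∫ x in Ω, twoPhase σc σs D x * ‖h.choose.2 x‖ ^ 2
  else 0

/-- The two expressions for the torsional rigidity agree: `∫_Ω σ|∇u|² = ∫_Ω u`. -/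
theorem IsWeakSolution.energy_eq {N : ℕ} {σc σs : ℝ} {D Ω : Set (Space N)} {u : Space N → ℝ}
    {g : Space N → Space N} (h : IsWeakSolution σc σs D Ω u g) :
    ∫ x in Ω, twoPhase σc σs D x * ‖g x‖ ^ 2 = ∫ x in Ω, u x := by
  rw [← h.weak u g h.mem]
  simp only [real_inner_self_eq_norm_sq]

end

noncomputable section

/-! ### Pairings in `L²` -/

section Pairing

variable {α E : Type*} [MeasurableSpace α] {μ : Measure α} [NormedAddCommGroup E]
  [InnerProductSpace ℝ E]

/-! On concentric balls the solution is radial and its gradient is `p = -x/(Nσ)`. The flux `σ p =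
-x/N` has divergence `-1` whatever the core and the domain are, so `p` remains an admissible dual
field after perturbation. This makes it possible to enclose the energy between two variational
bounds, without differentiating the state or using its regularity across the interface.

Let `P` be the dual energy `∫ σ|p|²` on the perturbed pair. Thomson's principle
(`IsWeakSolution.energy_le`) gives `E ≤ P`. Dirichlet's principle (`IsWeakSolution.le_energy`) gives
`E ≥ P - ∫ σ|p - ∇ψ|²` for every `ψ` in `H¹₀`. With `S` the inverse of `Id + Ψ`, the competitor is
the radial solution composed with `S`. The perturbed core is the preimage of `B_R` under `S`, so
`∇ψ` carries the same `σ` as `p`, and `p - ∇ψ = -(Nσ)⁻¹ (x - DSᵀ S x)` is `O(‖Ψ‖)`. The defect is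
quadratic, and `E = P + O(‖Ψ‖²)` (`abs_torsionalRigidity_sub_le`).

Next, `P` is a combination of `∫_Ω |x|²` and `∫_D |x|²`. As volumes are fixed, `|x|²` may be
replaced by `|x|² - r²`, which is `O(‖Ψ‖)` on an annulus around the sphere of radius `r`. The volume
of the annulus tends to `0`, so `P` changes by `o(‖Ψ‖)` (`abs_setIntegral_norm_sq_sub_le`). Finally
`‖Φ t‖ = O(t)`, and the energy changes by `o(t)`. -/

theorem integrable_inner_of_memLp {a b : α → E} (ha : MemLp a 2 μ) (hb : MemLp b 2 μ) :
    Integrable (fun x => inner ℝ (a x) (b x)) μ := by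
  refine (L2.integrable_inner (𝕜 := ℝ) (ha.toLp a) (hb.toLp b)).congr ?_
  filter_upwards [ha.coeFn_toLp, hb.coeFn_toLp] with x h1 h2
  rw [h1, h2]

theorem inner_toLp_toLp {a b : α → E} (ha : MemLp a 2 μ) (hb : MemLp b 2 μ) :
    inner ℝ (ha.toLp a) (hb.toLp b) = ∫ x, inner ℝ (a x) (b x) ∂μ := by
  rw [L2.inner_def]
  refine integral_congr_ae ?_
  filter_upwards [ha.coeFn_toLp, hb.coeFn_toLp] with x h1 h2
  rw [h1, h2]

theorem tendsto_integral_inner {a f : α → E} {F : ℕ → α → E} (ha : MemLp a 2 μ)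
    (hF : ∀ n, MemLp (F n) 2 μ) (hf : MemLp f 2 μ)
    (h : Tendsto (fun n => eLpNorm (F n - f) 2 μ) atTop (𝓝 0)) :
    Tendsto (fun n => ∫ x, inner ℝ (a x) (F n x) ∂μ) atTop (𝓝 (∫ x, inner ℝ (a x) (f x) ∂μ)) := by
  have h' := (Lp.tendsto_Lp_iff_tendsto_eLpNorm'' F hF f hf).2 h
  have := (tendsto_const_nhds (x := ha.toLp a)).inner (𝕜 := ℝ) h'
  simpa only [inner_toLp_toLp] using this

theorem tendsto_integral_mul {a f : α → ℝ} {F : ℕ → α → ℝ} (ha : MemLp a 2 μ)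
    (hF : ∀ n, MemLp (F n) 2 μ) (hf : MemLp f 2 μ)
    (h : Tendsto (fun n => eLpNorm (F n - f) 2 μ) atTop (𝓝 0)) :
    Tendsto (fun n => ∫ x, F n x * a x ∂μ) atTop (𝓝 (∫ x, f x * a x ∂μ)) := by
  simpa using tendsto_integral_inner ha hF hf h

theorem tendsto_integral_of_tendsto_eLpNorm [IsFiniteMeasure μ] {f : α → ℝ} {F : ℕ → α → ℝ}
    (hF : ∀ n, MemLp (F n) 2 μ) (hf : MemLp f 2 μ)
    (h : Tendsto (fun n => eLpNorm (F n - f) 2 μ) atTop (𝓝 0)) :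
    Tendsto (fun n => ∫ x, F n x ∂μ) atTop (𝓝 (∫ x, f x ∂μ)) := by
  simpa using tendsto_integral_mul (memLp_const (1 : ℝ)) hF hf h

end Pairing

theorem tendsto_eLpNorm_sub_of_uniform {α E : Type*} [MeasurableSpace α]
    [NormedAddCommGroup E] {μ : Measure α} [IsFiniteMeasure μ] {f : α → E} {F : ℕ → α → E}
    {δ : ℕ → ℝ} (hδ : Tendsto δ atTop (𝓝 0)) (h : ∀ n x, ‖F n x - f x‖ ≤ δ n) :
    Tendsto (fun n => eLpNorm (F n - f) 2 μ) atTop (𝓝 0) := by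
  have h1 : Tendsto (fun n => μ Set.univ ^ (2 : ENNReal).toReal⁻¹ * ENNReal.ofReal (δ n)) atTop
      (𝓝 0) := by
    have := ENNReal.Tendsto.const_mul (a := μ Set.univ ^ (2 : ENNReal).toReal⁻¹)
      ((ENNReal.continuous_ofReal.tendsto 0).comp hδ)
      (Or.inr (ENNReal.rpow_ne_top_of_nonneg (by positivity) (measure_ne_top μ _)))
    simpa using this
  exact tendsto_of_tendsto_of_tendsto_of_le_of_le tendsto_const_nhds h1 (fun _ => zero_le)
    fun n => eLpNorm_le_of_ae_bound (Eventually.of_forall fun x => h n x)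

/-! ### Compactly supported functions of class `C¹` -/

section Gradient

variable {N : ℕ} {f φ : Space N → ℝ}

theorem inner_gradient (f : Space N → ℝ) (x v : Space N) :
    inner ℝ (gradient f x) v = fderiv ℝ f x v := by
  simp [gradient]

theorem continuous_gradient (hf : ContDiff ℝ 1 f) : Continuous (gradient f) :=
  (InnerProductSpace.toDual ℝ (Space N)).symm.continuous.comp (hf.continuous_fderiv (by norm_num))

theorem norm_gradient_sub (hx : Space N) :
    ‖gradient f hx - gradient φ hx‖ = ‖fderiv ℝ f hx - fderiv ℝ φ hx‖ := by
  simp [gradient, ← map_sub]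

theorem support_gradient_subset : Function.support (gradient f) ⊆ tsupport f := by
  refine subset_trans ?_ (support_fderiv_subset ℝ)
  intro x hx h
  exact hx (by simp [gradient, h])

theorem HasCompactSupport.gradient (hc : HasCompactSupport f) : HasCompactSupport (gradient f) :=
  hc.mono' support_gradient_subset

theorem memLp_gradient (hf : ContDiff ℝ 1 f) (hc : HasCompactSupport f) {μ : Measure (Space N)}
    [IsFiniteMeasureOnCompacts μ] : MemLp (_root_.gradient f) 2 μ :=
  (continuous_gradient hf).memLp_of_hasCompactSupport hc.gradient

theorem setIntegral_eq_of_tsupport {E : Type*} [NormedAddCommGroup E] [NormedSpace ℝ E]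
    {Ω : Set (Space N)} (hs : tsupport f ⊆ Ω) {F : Space N → E}
    (hF : ∀ x, x ∉ tsupport f → F x = 0) : ∫ x in Ω, F x = ∫ x, F x :=
  setIntegral_eq_integral_of_forall_compl_eq_zero fun x hx => hF x fun h => hx (hs h)

theorem integral_mul_fderiv (hf : ContDiff ℝ 1 f) (hφ : ContDiff ℝ 1 φ) (hc : HasCompactSupport φ)
    (v : Space N) : ∫ x, f x * fderiv ℝ φ x v = -∫ x, fderiv ℝ f x v * φ x := by
  have c1 : Continuous fun x => fderiv ℝ f x v :=
    (hf.continuous_fderiv (by norm_num)).clm_apply continuous_const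
  have c2 : Continuous fun x => fderiv ℝ φ x v :=
    (hφ.continuous_fderiv (by norm_num)).clm_apply continuous_const
  refine integral_mul_fderiv_eq_neg_fderiv_mul_of_integrable ?_ ?_ ?_
    (fun x _ => hf.differentiable (by norm_num) x) (fun x _ => hφ.differentiable (by norm_num) x)
  · exact (c1.mul hφ.continuous).integrable_of_hasCompactSupport hc.mul_left
  · exact (hf.continuous.mul c2).integrable_of_hasCompactSupport (hc.fderiv_apply ℝ v).mul_left
  · exact (hf.continuous.mul hφ.continuous).integrable_of_hasCompactSupport hc.mul_left

/-- The field `-x/N` has divergence `-1`. -/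
theorem integral_inner_id_gradient (hf : ContDiff ℝ 1 f) (hc : HasCompactSupport f) :
    ∫ x, inner ℝ x (gradient f x) = -(N * ∫ x, f x) := by
  -- Integration by parts in one coordinate direction at a time; summing the `N` directions produces
  -- the factor `N`.
  have key : ∀ i : Fin N, ∫ x : Space N, x i * fderiv ℝ f x (EuclideanSpace.single i 1) =
      -∫ x, f x := by
    intro i
    have hd : ∀ x : Space N, fderiv ℝ (fun y : Space N => y i) x (EuclideanSpace.single i 1) = 1 := by
      intro x
      have : (fun y : Space N => y i) = (EuclideanSpace.proj i : Space N →L[ℝ] ℝ) := rfl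
      rw [this, ContinuousLinearMap.fderiv]
      simp
    have := integral_mul_fderiv (f := fun y : Space N => y i)
      (EuclideanSpace.proj i : Space N →L[ℝ] ℝ).contDiff hf hc (EuclideanSpace.single i 1)
    simpa [hd] using this
  have hsum : ∀ x : Space N, inner ℝ x (gradient f x) =
      ∑ i, x i * fderiv ℝ f x (EuclideanSpace.single i 1) := by
    intro x
    rw [real_inner_comm, inner_gradient]
    have h := congrArg (fderiv ℝ f x) ((EuclideanSpace.basisFun (Fin N) ℝ).sum_repr x)
    rw [← h]
    simp [map_sum]
  simp_rw [hsum]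
  rw [integral_finsetSum]
  · simp [key]
  · intro i _
    refine Continuous.integrable_of_hasCompactSupport ?_ (hc.fderiv_apply ℝ _).mul_left
    exact (EuclideanSpace.proj i : Space N →L[ℝ] ℝ).continuous.mul
      ((hf.continuous_fderiv (by norm_num)).clm_apply continuous_const)

theorem setIntegral_inner_id_gradient {Ω : Set (Space N)} (hf : ContDiff ℝ 1 f)
    (hc : HasCompactSupport f) (hs : tsupport f ⊆ Ω) :
    ∫ x in Ω, inner ℝ x (gradient f x) = -(N * ∫ x in Ω, f x) := by
  rw [setIntegral_eq_of_tsupport hs, setIntegral_eq_of_tsupport hs,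
    integral_inner_id_gradient hf hc]
  · exact fun x => image_eq_zero_of_notMem_tsupport
  · intro x hx
    rw [Function.notMem_support.1 fun h => hx (support_gradient_subset h), inner_zero_right]

/-- The Poincaré inequality. -/
theorem integral_sq_le_of_tsupport (hN : N ≠ 0) {Ω : Set (Space N)} {ρ : ℝ}
    (hρ : ∀ x ∈ Ω, ‖x‖ ≤ ρ) (hf : ContDiff ℝ 1 f)
    (hc : HasCompactSupport f) (hs : tsupport f ⊆ Ω) :
    ∫ x in Ω, f x ^ 2 ≤ (2 * ρ / N) ^ 2 * ∫ x in Ω, ‖gradient f x‖ ^ 2 := by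
  have hN' : (0 : ℝ) < N := by positivity
  have hcg : Continuous (gradient f) := continuous_gradient hf
  have hc2 : HasCompactSupport fun x => f x ^ 2 :=
    hc.comp_left (g := fun y : ℝ => y ^ 2) (by simp)
  -- The divergence identity applied to `f²` gives `N ∫ f² = -∫ 2 f x·∇f`, and `|x| ≤ ρ` on the
  -- support.
  have h1 := integral_inner_id_gradient (f := fun x => f x ^ 2) (hf.pow 2) hc2
  have hgr : ∀ x, gradient (fun x => f x ^ 2) x = (2 * f x) • gradient f x := by
    intro x
    have := (hf.differentiable (by norm_num) x).hasFDerivAt.pow 2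
    refine ext_inner_right ℝ fun v => ?_
    rw [inner_gradient, this.fderiv, inner_smul_left, inner_gradient]
    simp
  simp only [hgr, inner_smul_right] at h1
  have hz : ∀ x, x ∉ tsupport f → f x = 0 := fun x => image_eq_zero_of_notMem_tsupport
  have hz' : ∀ x, x ∉ tsupport f → gradient f x = 0 := fun x hx =>
    Function.notMem_support.1 fun h => hx (support_gradient_subset h)
  rw [setIntegral_eq_of_tsupport hs fun x hx => by simp [hz x hx],
    setIntegral_eq_of_tsupport hs fun x hx => by simp [hz' x hx]]
  have hcgn : HasCompactSupport fun x => ‖gradient f x‖ ^ 2 :=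
    hc.gradient.comp_left (g := fun y => ‖y‖ ^ 2) (by simp)
  have i1 : Integrable fun x => f x ^ 2 :=
    (hf.continuous.pow 2).integrable_of_hasCompactSupport hc2
  have i2 : Integrable fun x => ‖gradient f x‖ ^ 2 :=
    (hcg.norm.pow 2).integrable_of_hasCompactSupport hcgn
  have hle : -∫ x, 2 * f x * inner ℝ x (gradient f x) ≤
      ∫ x, (N / 2 * f x ^ 2 + 2 * ρ ^ 2 / N * ‖gradient f x‖ ^ 2) := by
    rw [← integral_neg]
    refine integral_mono ?_ ((i1.const_mul _).add (i2.const_mul _)) fun x => ?_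
    · refine Integrable.neg (Continuous.integrable_of_hasCompactSupport ?_ ?_)
      · exact (continuous_const.mul hf.continuous).mul (continuous_id.inner hcg)
      · exact (hc.mul_left (f := fun _ => (2 : ℝ))).mul_right
    · by_cases hx : x ∈ tsupport f
      · have h2 : |inner ℝ x (gradient f x)| ≤ ρ * ‖gradient f x‖ :=
          (abs_real_inner_le_norm _ _).trans (by gcongr; exact hρ x (hs hx))
        have h3 : -(2 * f x * inner ℝ x (gradient f x)) ≤ 2 * |f x| * (ρ * ‖gradient f x‖) := by
          calc _ ≤ |2 * f x * inner ℝ x (gradient f x)| := neg_le_abs _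
            _ = 2 * |f x| * |inner ℝ x (gradient f x)| := by rw [abs_mul, abs_mul]; simp
            _ ≤ _ := by gcongr
        refine h3.trans ?_
        -- Young's inequality, weighted so that `N/2 ∫ f²` can be absorbed on the left; what remains
        -- yields the constant `(2ρ/N)²`.
        have h4 : 0 ≤ (N * |f x| - 2 * (ρ * ‖gradient f x‖)) ^ 2 / (2 * N) := by positivity
        have h5 : (N * |f x| - 2 * (ρ * ‖gradient f x‖)) ^ 2 / (2 * N) =
            N / 2 * |f x| ^ 2 + 2 * ρ ^ 2 / N * ‖gradient f x‖ ^ 2 -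
              2 * |f x| * (ρ * ‖gradient f x‖) := by
          field_simp
          ring
        rw [sq_abs] at h5
        linarith
      · simp [hz x hx, hz' x hx]
  rw [h1, neg_neg, integral_add (i1.const_mul _) (i2.const_mul _), integral_const_mul,
    integral_const_mul] at hle
  have h6 : (2 * ρ / N) ^ 2 * ∫ x, ‖gradient f x‖ ^ 2 =
      2 / N * (2 * ρ ^ 2 / N * ∫ x, ‖gradient f x‖ ^ 2) := by
    field_simp
  rw [h6]
  have h7 : ∫ x, f x ^ 2 = 2 / N * (N * (∫ x, f x ^ 2) - N / 2 * ∫ x, f x ^ 2) := by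
    field_simp
    norm_num
  rw [h7]
  gcongr
  linarith

theorem eLpNorm_two_eq_ofReal {α E : Type*} [MeasurableSpace α] {μ : Measure α}
    [NormedAddCommGroup E] {g : α → E} (hg : MemLp g 2 μ) :
    eLpNorm g 2 μ = ENNReal.ofReal (√(∫ x, ‖g x‖ ^ 2 ∂μ)) := by
  rw [hg.eLpNorm_eq_integral_rpow_norm (by norm_num) (by norm_num), Real.sqrt_eq_rpow]
  simp

theorem eLpNorm_le_eLpNorm_gradient (hN : N ≠ 0) {Ω : Set (Space N)} {ρ : ℝ} (hρ0 : 0 ≤ ρ)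
    (hρ : ∀ x ∈ Ω, ‖x‖ ≤ ρ) (hf : ContDiff ℝ 1 f)
    (hc : HasCompactSupport f) (hs : tsupport f ⊆ Ω) :
    eLpNorm f 2 (volume.restrict Ω) ≤
      ENNReal.ofReal (2 * ρ / N) * eLpNorm (gradient f) 2 (volume.restrict Ω) := by
  have hN' : (0 : ℝ) < N := by positivity
  rw [eLpNorm_two_eq_ofReal (hf.continuous.memLp_of_hasCompactSupport hc),
    eLpNorm_two_eq_ofReal (memLp_gradient hf hc), ← ENNReal.ofReal_mul (by positivity)]
  refine ENNReal.ofReal_le_ofReal ?_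
  rw [Real.sqrt_le_left (by positivity), mul_pow, Real.sq_sqrt (by positivity)]
  simpa using integral_sq_le_of_tsupport hN hρ hf hc hs

end Gradient

/-! ### Mollification -/

/-- Convolution with a bump of small radius commutes with differentiation, and `f` and `Df` are
uniformly continuous by compact support. This is needed because the competitors are only `C¹`. -/
theorem exists_isTestFunction_near {N : ℕ} {Ω : Set (Space N)} (hΩ : IsOpen Ω) {f : Space N → ℝ}
    (hf : ContDiff ℝ 1 f) (hc : HasCompactSupport f) (hs : tsupport f ⊆ Ω) {ε : ℝ} (hε : 0 < ε) :
    ∃ φ, IsTestFunction Ω φ ∧ (∀ x, ‖φ x - f x‖ ≤ ε) ∧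
      ∀ x, ‖gradient φ x - gradient f x‖ ≤ ε := by
  have hcf : Continuous (fderiv ℝ f) := hf.continuous_fderiv (by norm_num)
  obtain ⟨δ₁, hδ₁, h₁⟩ := Metric.uniformContinuous_iff.1
    (hc.uniformContinuous_of_continuous hf.continuous) ε hε
  obtain ⟨δ₂, hδ₂, h₂⟩ := Metric.uniformContinuous_iff.1
    ((hc.fderiv ℝ).uniformContinuous_of_continuous hcf) ε hε
  -- Mollification enlarges the support by at most the radius of the bump; `δ₃` keeps it inside `Ω`.
  obtain ⟨δ₃, hδ₃, h₃⟩ := hc.isCompact.exists_cthickening_subset_open hΩ hs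
  set δ := min δ₁ (min δ₂ δ₃) with hδ
  have hδ0 : 0 < δ := lt_min hδ₁ (lt_min hδ₂ hδ₃)
  let b : ContDiffBump (0 : Space N) := ⟨δ / 2, δ, by positivity, by linarith⟩
  let φ : Space N → ℝ := convolution (b.normed volume) f (ContinuousLinearMap.lsmul ℝ ℝ) volume
  have hbc : HasCompactSupport (b.normed (volume : Measure (Space N))) := b.hasCompactSupport_normed
  have hfd : ∀ x, HasFDerivAt φ (convolution (b.normed volume) (fderiv ℝ f)
      (ContinuousLinearMap.lsmul ℝ ℝ) volume x) x := by
    intro x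
    have := hc.hasFDerivAt_convolution_right (ContinuousLinearMap.lsmul ℝ ℝ)
      ((b.continuous_normed (μ := volume)).locallyIntegrable (μ := volume)) hf x
    have hL : (ContinuousLinearMap.lsmul ℝ ℝ : ℝ →L[ℝ] ℝ →L[ℝ] ℝ).precompR (Space N) =
        ContinuousLinearMap.lsmul ℝ ℝ := by
      ext
      simp
    rwa [hL] at this
  have hsupp : tsupport φ ⊆ Metric.cthickening δ (tsupport f) := by
    refine closure_minimal ?_ Metric.isClosed_cthickening
    refine (support_convolution_subset _).trans ?_
    rintro _ ⟨y, hy, z, hz, rfl⟩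
    rw [b.support_normed_eq] at hy
    refine Metric.mem_cthickening_of_dist_le _ z _ _ (subset_tsupport f hz) ?_
    have : dist (y + z) z = ‖y‖ := by simp [dist_eq_norm]
    simp only [this]
    exact (mem_ball_zero_iff.1 hy).le
  refine ⟨φ, ⟨hbc.contDiff_convolution_left _ b.contDiff_normed (μ := volume) hf.continuous.locallyIntegrable,
    hbc.convolution _ hc, ?_⟩, fun x => ?_, fun x => ?_⟩
  · refine hsupp.trans ((Metric.cthickening_mono ?_ _).trans h₃)
    exact (min_le_right _ _).trans (min_le_right _ _)
  · rw [← dist_eq_norm]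
    refine b.dist_normed_convolution_le hf.continuous.aestronglyMeasurable fun y hy => ?_
    exact (h₁ (lt_of_lt_of_le hy (min_le_left _ _))).le
  · rw [norm_gradient_sub, ← dist_eq_norm, (hfd x).fderiv]
    refine b.dist_normed_convolution_le hcf.aestronglyMeasurable fun y hy => ?_
    exact (h₂ (lt_of_lt_of_le hy ((min_le_right _ _).trans (min_le_left _ _)))).le


/-! ### Test functions and `H¹₀` -/

section TestFunctions

variable {N : ℕ} {Ω : Set (Space N)} {φ χ f : Space N → ℝ}

theorem IsTestFunction.contDiff_one (h : IsTestFunction Ω φ) : ContDiff ℝ 1 φ :=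
  h.1.of_le (by exact_mod_cast le_top)

theorem IsTestFunction.memLp (h : IsTestFunction Ω φ) : MemLp φ 2 (volume.restrict Ω) :=
  h.contDiff_one.continuous.memLp_of_hasCompactSupport h.2.1

theorem IsTestFunction.memLp_gradient (h : IsTestFunction Ω φ) :
    MemLp (gradient φ) 2 (volume.restrict Ω) :=
  _root_.memLp_gradient h.contDiff_one h.2.1

theorem gradient_add_fun (hφ : ContDiff ℝ 1 φ) (hχ : ContDiff ℝ 1 χ) :
    gradient (φ + χ) = gradient φ + gradient χ := by
  funext x
  refine ext_inner_right ℝ fun v => ?_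
  rw [Pi.add_apply, inner_add_left, inner_gradient, inner_gradient, inner_gradient,
    fderiv_add (hφ.differentiable (by norm_num) x) (hχ.differentiable (by norm_num) x)]
  rfl

theorem gradient_smul_fun (hφ : ContDiff ℝ 1 φ) (c : ℝ) :
    gradient (c • φ) = c • gradient φ := by
  funext x
  refine ext_inner_right ℝ fun v => ?_
  rw [Pi.smul_apply, inner_smul_left, inner_gradient, inner_gradient,
    fderiv_const_smul (hφ.differentiable (by norm_num) x)]
  rfl

theorem IsTestFunction.zero : IsTestFunction Ω 0 :=
  ⟨contDiff_const, HasCompactSupport.zero, by simp [tsupport]⟩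

theorem IsTestFunction.add (h : IsTestFunction Ω φ) (h' : IsTestFunction Ω χ) :
    IsTestFunction Ω (φ + χ) :=
  ⟨h.1.add h'.1, h.2.1.add h'.2.1,
    (tsupport_add _ _).trans (Set.union_subset h.2.2 h'.2.2)⟩

theorem IsTestFunction.const_smul (h : IsTestFunction Ω φ) (c : ℝ) : IsTestFunction Ω (c • φ) :=
  ⟨h.1.const_smul c, h.2.1.mono (Function.support_const_smul_subset c φ),
    (closure_mono (Function.support_const_smul_subset c φ)).trans h.2.2⟩

theorem IsTestFunction.sub (h : IsTestFunction Ω φ) (h' : IsTestFunction Ω χ) :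
    IsTestFunction Ω (φ - χ) := by
  have := h.add (h'.const_smul (-1))
  rwa [neg_one_smul, ← sub_eq_add_neg] at this

theorem gradient_sub_fun (hφ : ContDiff ℝ 1 φ) (hχ : ContDiff ℝ 1 χ) :
    gradient (φ - χ) = gradient φ - gradient χ := by
  have hχ' : ContDiff ℝ 1 ((-1 : ℝ) • χ) := hχ.const_smul (-1 : ℝ)
  have := gradient_add_fun hφ hχ'
  rw [gradient_smul_fun hχ, neg_one_smul, ← sub_eq_add_neg] at this
  rw [this, neg_one_smul, ← sub_eq_add_neg]

/-- Integration by parts against a fixed test function is continuous under `L²` convergence, so the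
weak gradient identity is inherited from the approximating sequence. -/
theorem MemH10.of_tendsto {u : Space N → ℝ} {g : Space N → Space N} {φ : ℕ → Space N → ℝ}
    (hu : MemLp u 2 (volume.restrict Ω)) (hg : MemLp g 2 (volume.restrict Ω))
    (hφ : ∀ n, IsTestFunction Ω (φ n))
    (h1 : Tendsto (fun n => eLpNorm (φ n - u) 2 (volume.restrict Ω)) atTop (𝓝 0))
    (h2 : Tendsto (fun n => eLpNorm (gradient (φ n) - g) 2 (volume.restrict Ω)) atTop (𝓝 0)) :
    MemH10 Ω u g where
  memLp := hu
  memLp_grad := hg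
  approx := ⟨φ, hφ, h1, h2⟩
  weak_grad := by
    intro χ hχ v
    have c2 : Continuous fun x => fderiv ℝ χ x v :=
      (hχ.contDiff_one.continuous_fderiv (by norm_num)).clm_apply continuous_const
    have l1 := tendsto_integral_mul
      (c2.memLp_of_hasCompactSupport (hχ.2.1.fderiv_apply ℝ v)) (fun n => (hφ n).memLp) hu h1
    have hχv : MemLp (fun x => χ x • v) 2 (volume.restrict Ω) :=
      (hχ.contDiff_one.continuous.smul continuous_const).memLp_of_hasCompactSupport
        hχ.2.1.smul_right
    have l2 := (tendsto_integral_inner hχv (fun n => (hφ n).memLp_gradient) hg h2).neg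
    have e : ∀ n, ∫ x in Ω, φ n x * fderiv ℝ χ x v =
        -∫ x in Ω, inner ℝ (χ x • v) (gradient (φ n) x) := by
      intro n
      have := integral_mul_fderiv (hφ n).contDiff_one hχ.contDiff_one hχ.2.1 v
      rw [setIntegral_eq_of_tsupport (hφ n).2.2, setIntegral_eq_of_tsupport hχ.2.2, this]
      · congr 2
        funext x
        rw [inner_smul_left, real_inner_comm, inner_gradient, mul_comm]
        rfl
      · intro x hx
        rw [image_eq_zero_of_notMem_tsupport hx, zero_smul, inner_zero_left]
      · intro x hx
        rw [image_eq_zero_of_notMem_tsupport hx, zero_mul]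
    simp only [e] at l1
    rw [tendsto_nhds_unique l1 l2]
    congr 2
    funext x
    rw [inner_smul_left, real_inner_comm, mul_comm]
    rfl

theorem MemH10.of_contDiff (hΩ : IsOpen Ω) [IsFiniteMeasure (volume.restrict Ω)]
    (hf : ContDiff ℝ 1 f) (hc : HasCompactSupport f) (hs : tsupport f ⊆ Ω) :
    MemH10 Ω f (gradient f) := by
  choose φ h1 h2 h3 using fun n : ℕ =>
    exists_isTestFunction_near hΩ hf hc hs (ε := 1 / ((n : ℝ) + 1)) (by positivity)
  exact MemH10.of_tendsto (hf.continuous.memLp_of_hasCompactSupport hc)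
    (_root_.memLp_gradient hf hc) h1
    (tendsto_eLpNorm_sub_of_uniform tendsto_one_div_add_atTop_nhds_zero_nat h2)
    (tendsto_eLpNorm_sub_of_uniform tendsto_one_div_add_atTop_nhds_zero_nat h3)

end TestFunctions

/-! ### The coefficient and the dual field -/

section Coefficient

variable {N : ℕ} {σc σs : ℝ} {D : Set (Space N)}

theorem measurable_twoPhase (hD : MeasurableSet D) : Measurable (twoPhase σc σs D) :=
  Measurable.ite hD measurable_const measurable_const

theorem min_le_twoPhase (x : Space N) : min σc σs ≤ twoPhase σc σs D x := by
  unfold twoPhase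
  split_ifs
  exacts [min_le_left _ _, min_le_right _ _]

theorem twoPhase_le_max (x : Space N) : twoPhase σc σs D x ≤ max σc σs := by
  unfold twoPhase
  split_ifs
  exacts [le_max_left _ _, le_max_right _ _]

theorem twoPhase_pos (hc : 0 < σc) (hs : 0 < σs) (x : Space N) : 0 < twoPhase σc σs D x :=
  (lt_min hc hs).trans_le (min_le_twoPhase x)

theorem MemLp.twoPhase_smul {μ : Measure (Space N)} (hc : 0 < σc) (hs : 0 < σs)
    (hD : MeasurableSet D) {a : Space N → Space N} (ha : MemLp a 2 μ) :
    MemLp (fun x => twoPhase σc σs D x • a x) 2 μ := by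
  refine ha.of_le_mul (c := max σc σs)
    ((measurable_twoPhase hD).aestronglyMeasurable.smul ha.1) (Eventually.of_forall fun x => ?_)
  rw [norm_smul, Real.norm_of_nonneg (twoPhase_pos hc hs x).le]
  gcongr
  exact twoPhase_le_max x

theorem integrable_twoPhase_mul_inner {μ : Measure (Space N)} (hc : 0 < σc) (hs : 0 < σs)
    (hD : MeasurableSet D) {a b : Space N → Space N} (ha : MemLp a 2 μ) (hb : MemLp b 2 μ) :
    Integrable (fun x => twoPhase σc σs D x * inner ℝ (a x) (b x)) μ := by
  simpa only [real_inner_smul_left] using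
    integrable_inner_of_memLp (MemLp.twoPhase_smul hc hs hD ha) hb

/-- The field `p` with `σ p = -x/N`, so that `-div (σ p) = 1`. -/
def dualField (σc σs : ℝ) (D : Set (Space N)) (x : Space N) : Space N :=
  -(N * twoPhase σc σs D x)⁻¹ • x

theorem norm_dualField_le (hN : N ≠ 0) (hc : 0 < σc) (hs : 0 < σs) (x : Space N) :
    ‖dualField σc σs D x‖ ≤ (N * min σc σs)⁻¹ * ‖x‖ := by
  have hm : 0 < min σc σs := lt_min hc hs
  have hN' : (0 : ℝ) < N := by positivity
  have hp := twoPhase_pos (D := D) hc hs x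
  rw [dualField, norm_smul, norm_neg, Real.norm_of_nonneg (by positivity)]
  gcongr
  exact min_le_twoPhase x

theorem twoPhase_mul_inner_dualField (hN : N ≠ 0) (hc : 0 < σc) (hs : 0 < σs) (x v : Space N) :
    twoPhase σc σs D x * inner ℝ (dualField σc σs D x) v = -(N : ℝ)⁻¹ * inner ℝ x v := by
  have hp := twoPhase_pos (D := D) hc hs x
  have hN' : (N : ℝ) ≠ 0 := by positivity
  rw [dualField, real_inner_smul_left]
  field_simp

theorem measurable_dualField (hD : MeasurableSet D) : Measurable (dualField σc σs D) :=
  (((measurable_twoPhase hD).const_mul _).inv.neg).smul measurable_id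

theorem memLp_dualField (hN : N ≠ 0) (hc : 0 < σc) (hs : 0 < σs) (hD : MeasurableSet D)
    {Ω : Set (Space N)} (hΩ : MeasurableSet Ω) [IsFiniteMeasure (volume.restrict Ω)] {ρ : ℝ}
    (hρ : ∀ x ∈ Ω, ‖x‖ ≤ ρ) : MemLp (dualField σc σs D) 2 (volume.restrict Ω) := by
  have hm : 0 < min σc σs := lt_min hc hs
  refine MemLp.of_bound (measurable_dualField hD).aestronglyMeasurable
    ((N * min σc σs)⁻¹ * ρ) ?_
  filter_upwards [ae_restrict_mem hΩ] with x hx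
  refine (norm_dualField_le hN hc hs x).trans ?_
  gcongr
  exact hρ x hx

end Coefficient

/-! ### Dual field, variational principles and uniqueness. -/

section WeakSolutions

variable {N : ℕ} {σc σs : ℝ} {D Ω : Set (Space N)} {ρ : ℝ}

/-- The dual field is an admissible flux. -/
theorem MemH10.integral_twoPhase_mul_inner_dualField (hN : N ≠ 0) (hc : 0 < σc) (hs : 0 < σs)
    (hD : MeasurableSet D) (hΩ : MeasurableSet Ω) [IsFiniteMeasure (volume.restrict Ω)]
    (hρ : ∀ x ∈ Ω, ‖x‖ ≤ ρ) {ψ : Space N → ℝ} {ζ : Space N → Space N} (h : MemH10 Ω ψ ζ) :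
    ∫ x in Ω, twoPhase σc σs D x * inner ℝ (dualField σc σs D x) (ζ x) = ∫ x in Ω, ψ x := by
  obtain ⟨φ, hφ, h1, h2⟩ := h.approx
  have hp := MemLp.twoPhase_smul hc hs hD (memLp_dualField hN hc hs hD hΩ hρ)
  have l1 := tendsto_integral_inner hp (fun n => (hφ n).memLp_gradient) h.memLp_grad h2
  have l2 := tendsto_integral_of_tendsto_eLpNorm (fun n => (hφ n).memLp) h.memLp h1
  simp only [real_inner_smul_left] at l1
  refine tendsto_nhds_unique l1 ?_
  convert l2 using 2 with n
  -- For test functions `σ` cancels and the identity is the divergence theorem for `-x/N`,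
  -- independently of `D`.
  simp only [twoPhase_mul_inner_dualField hN hc hs]
  rw [integral_const_mul, setIntegral_inner_id_gradient (hφ n).contDiff_one (hφ n).2.1 (hφ n).2.2]
  have : (N : ℝ) ≠ 0 := by positivity
  field_simp

theorem integral_twoPhase_mul_norm_sub_sq {μ : Measure (Space N)} (hc : 0 < σc) (hs : 0 < σs)
    (hD : MeasurableSet D) {a b : Space N → Space N} (ha : MemLp a 2 μ) (hb : MemLp b 2 μ) :
    ∫ x, twoPhase σc σs D x * ‖a x - b x‖ ^ 2 ∂μ =
      ∫ x, twoPhase σc σs D x * inner ℝ (a x) (a x) ∂μ -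
        2 * ∫ x, twoPhase σc σs D x * inner ℝ (a x) (b x) ∂μ +
        ∫ x, twoPhase σc σs D x * inner ℝ (b x) (b x) ∂μ := by
  have i1 := integrable_twoPhase_mul_inner hc hs hD ha ha
  have i2 := (integrable_twoPhase_mul_inner hc hs hD ha hb).const_mul 2
  have i3 := integrable_twoPhase_mul_inner hc hs hD hb hb
  have i12 : Integrable (fun x => twoPhase σc σs D x * inner ℝ (a x) (a x) -
      2 * (twoPhase σc σs D x * inner ℝ (a x) (b x))) μ := i1.sub i2
  rw [← integral_const_mul, ← integral_sub i1 i2, ← integral_add i12 i3]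
  congr 1
  funext x
  rw [norm_sub_sq_real, real_inner_self_eq_norm_sq, real_inner_self_eq_norm_sq]
  ring

theorem integral_twoPhase_mul_norm_sq_nonneg {μ : Measure (Space N)} (hc : 0 < σc) (hs : 0 < σs)
    (a : Space N → Space N) : 0 ≤ ∫ x, twoPhase σc σs D x * ‖a x‖ ^ 2 ∂μ :=
  integral_nonneg fun x => mul_nonneg (twoPhase_pos hc hs x).le (sq_nonneg _)

/-- Thomson's principle. -/
theorem IsWeakSolution.energy_le (hN : N ≠ 0) (hc : 0 < σc) (hs : 0 < σs)
    (hD : MeasurableSet D) (hΩ : MeasurableSet Ω) [IsFiniteMeasure (volume.restrict Ω)]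
    (hρ : ∀ x ∈ Ω, ‖x‖ ≤ ρ) {u : Space N → ℝ} {g : Space N → Space N}
    (h : IsWeakSolution σc σs D Ω u g) :
    ∫ x in Ω, twoPhase σc σs D x * ‖g x‖ ^ 2 ≤
      ∫ x in Ω, twoPhase σc σs D x * ‖dualField σc σs D x‖ ^ 2 := by
  have hp := memLp_dualField hN hc hs hD hΩ hρ
  -- In the expansion of `∫ σ|p - g|² ≥ 0` the cross term and the last term are both `∫ u`, so only
  -- `∫ σ|p|² - ∫ σ|g|²` is left.
  have e := integral_twoPhase_mul_norm_sub_sq hc hs hD hp h.mem.memLp_grad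
  have e0 := integral_twoPhase_mul_norm_sq_nonneg (D := D) (μ := volume.restrict Ω) hc hs
    fun x => dualField σc σs D x - g x
  have e1 := h.mem.integral_twoPhase_mul_inner_dualField hN hc hs hD hΩ hρ
  have e2 := h.energy_eq
  simp only [real_inner_self_eq_norm_sq] at e
  linarith

/-- Dirichlet's principle, with the defect written through the dual field. -/
theorem IsWeakSolution.le_energy (hN : N ≠ 0) (hc : 0 < σc) (hs : 0 < σs)
    (hD : MeasurableSet D) (hΩ : MeasurableSet Ω) [IsFiniteMeasure (volume.restrict Ω)]
    (hρ : ∀ x ∈ Ω, ‖x‖ ≤ ρ) {u : Space N → ℝ} {g : Space N → Space N}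
    (h : IsWeakSolution σc σs D Ω u g) {ψ : Space N → ℝ} {ζ : Space N → Space N}
    (hψ : MemH10 Ω ψ ζ) :
    (∫ x in Ω, twoPhase σc σs D x * ‖dualField σc σs D x‖ ^ 2) -
      ∫ x in Ω, twoPhase σc σs D x * ‖dualField σc σs D x - ζ x‖ ^ 2 ≤
    ∫ x in Ω, twoPhase σc σs D x * ‖g x‖ ^ 2 := by
  have hp := memLp_dualField hN hc hs hD hΩ hρ
  -- Both `p` and `g` pair with `ζ` to give `∫ ψ`. Hence the left-hand side is `2 ∫ ψ - ∫ σ|ζ|²`,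
  -- and `∫ σ|g - ζ|² ≥ 0` bounds it by the energy.
  have e := integral_twoPhase_mul_norm_sub_sq hc hs hD hp hψ.memLp_grad
  have e' := integral_twoPhase_mul_norm_sub_sq hc hs hD h.mem.memLp_grad hψ.memLp_grad
  have e0 := integral_twoPhase_mul_norm_sq_nonneg (D := D) (μ := volume.restrict Ω) hc hs
    fun x => g x - ζ x
  have e1 := hψ.integral_twoPhase_mul_inner_dualField hN hc hs hD hΩ hρ
  have e2 := h.weak _ _ hψ
  simp only [real_inner_self_eq_norm_sq] at e e'
  linarith

/-- Poincaré is available for test functions only, so it is applied to the difference of the two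
approximating sequences, whose gradients approach each other in `L²`. -/
theorem MemH10.ae_eq_of_ae_eq_grad (hN : N ≠ 0) (hρ0 : 0 ≤ ρ) (hρ : ∀ x ∈ Ω, ‖x‖ ≤ ρ)
    {u u' : Space N → ℝ} {g g' : Space N → Space N} (h : MemH10 Ω u g) (h' : MemH10 Ω u' g')
    (hg : g' =ᵐ[volume.restrict Ω] g) : u' =ᵐ[volume.restrict Ω] u := by
  obtain ⟨φ, hφ, h1, h2⟩ := h.approx
  obtain ⟨φ', hφ', h1', h2'⟩ := h'.approx
  set μ := volume.restrict Ω
  have key : ∀ n, eLpNorm (u' - u) 2 μ ≤ eLpNorm (φ' n - u') 2 μ + eLpNorm (φ n - u) 2 μ +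
      ENNReal.ofReal (2 * ρ / N) *
        (eLpNorm (gradient (φ' n) - g') 2 μ + eLpNorm (gradient (φ n) - g) 2 μ) := by
    intro n
    have a1 : eLpNorm (u' - u) 2 μ ≤ eLpNorm (u' - φ' n) 2 μ + eLpNorm (φ n - u) 2 μ +
        eLpNorm (φ' n - φ n) 2 μ := by
      have : u' - u = ((u' - φ' n) + (φ n - u)) + (φ' n - φ n) := by abel
      rw [this]
      refine (eLpNorm_add_le ?_ ?_ (by norm_num)).trans ?_
      · exact (h'.memLp.sub (hφ' n).memLp).1.add ((hφ n).memLp.sub h.memLp).1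
      · exact ((hφ' n).memLp.sub (hφ n).memLp).1
      gcongr
      exact eLpNorm_add_le (h'.memLp.sub (hφ' n).memLp).1 ((hφ n).memLp.sub h.memLp).1
        (by norm_num)
    rw [eLpNorm_sub_comm u' (φ' n)] at a1
    refine a1.trans ?_
    gcongr
    have ht := (hφ' n).sub (hφ n)
    refine (eLpNorm_le_eLpNorm_gradient hN hρ0 hρ ht.contDiff_one ht.2.1 ht.2.2).trans ?_
    gcongr
    rw [gradient_sub_fun (hφ' n).contDiff_one (hφ n).contDiff_one]
    have : gradient (φ' n) - gradient (φ n) =ᵐ[μ]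
        (gradient (φ' n) - g') + (g - gradient (φ n)) := by
      filter_upwards [hg] with x hx
      simp only [Pi.sub_apply, Pi.add_apply, hx]
      abel
    rw [eLpNorm_congr_ae this]
    refine (eLpNorm_add_le ((hφ' n).memLp_gradient.sub h'.memLp_grad).1
      (h.memLp_grad.sub (hφ n).memLp_gradient).1 (by norm_num)).trans ?_
    rw [eLpNorm_sub_comm g]
  have lim : Tendsto (fun n => eLpNorm (φ' n - u') 2 μ + eLpNorm (φ n - u) 2 μ +
      ENNReal.ofReal (2 * ρ / N) *
        (eLpNorm (gradient (φ' n) - g') 2 μ + eLpNorm (gradient (φ n) - g) 2 μ)) atTop (𝓝 0) := by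
    have := (h1'.add h1).add (ENNReal.Tendsto.const_mul (a := ENNReal.ofReal (2 * ρ / N))
      (h2'.add h2) (Or.inr ENNReal.ofReal_ne_top))
    simpa using this
  have h0 : eLpNorm (u' - u) 2 μ = 0 := le_antisymm (ge_of_tendsto' lim key) zero_le
  rw [eLpNorm_eq_zero_iff (h'.memLp.sub h.memLp).1 (by norm_num)] at h0
  filter_upwards [h0] with x hx
  exact sub_eq_zero.1 hx

/-- Testing each equation with both solutions makes `∫ σ|g' - g|²` vanish; the functions then agree
by Poincaré. -/
theorem IsWeakSolution.ae_eq (hN : N ≠ 0) (hc : 0 < σc) (hs : 0 < σs)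
    (hD : MeasurableSet D) (hρ0 : 0 ≤ ρ)
    (hρ : ∀ x ∈ Ω, ‖x‖ ≤ ρ) {u u' : Space N → ℝ} {g g' : Space N → Space N}
    (h : IsWeakSolution σc σs D Ω u g) (h' : IsWeakSolution σc σs D Ω u' g') :
    u' =ᵐ[volume.restrict Ω] u ∧ g' =ᵐ[volume.restrict Ω] g := by
  have hg : g' =ᵐ[volume.restrict Ω] g := by
    have e := integral_twoPhase_mul_norm_sub_sq hc hs hD h'.mem.memLp_grad h.mem.memLp_grad
    have e1 := h'.weak _ _ h.mem
    have e2 : ∫ x in Ω, twoPhase σc σs D x * inner ℝ (g' x) (g x) = ∫ x in Ω, u' x := by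
      simpa only [real_inner_comm] using h.weak _ _ h'.mem
    rw [h'.weak _ _ h'.mem, h.weak _ _ h.mem] at e
    have e3 : ∫ x in Ω, twoPhase σc σs D x * ‖g' x - g x‖ ^ 2 = 0 := by linarith
    rw [integral_eq_zero_iff_of_nonneg
      (fun x => mul_nonneg (twoPhase_pos hc hs x).le (sq_nonneg _))] at e3
    · filter_upwards [e3] with x hx
      have := (mul_eq_zero.1 hx).resolve_left (twoPhase_pos hc hs x).ne'
      exact sub_eq_zero.1 (norm_eq_zero.1 (pow_eq_zero_iff (two_ne_zero)|>.1 this))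
    · have hd := h'.mem.memLp_grad.sub h.mem.memLp_grad
      simpa only [Pi.sub_apply, real_inner_self_eq_norm_sq] using
        integrable_twoPhase_mul_inner hc hs hD hd hd
  exact ⟨h.mem.ae_eq_of_ae_eq_grad hN hρ0 hρ h'.mem hg, hg⟩

end WeakSolutions


/-! ### Existence of the weak solution -/

section Existence

variable {N : ℕ} {σc σs : ℝ} {D Ω : Set (Space N)} {ρ : ℝ}

theorem MemLp.sqrt_twoPhase_smul {μ : Measure (Space N)} (hD : MeasurableSet D)
    {a : Space N → Space N} (ha : MemLp a 2 μ) :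
    MemLp (fun x => √(twoPhase σc σs D x) • a x) 2 μ := by
  refine ha.of_le_mul (c := √(max σc σs))
    ((measurable_twoPhase hD).sqrt.aestronglyMeasurable.smul ha.1)
    (Eventually.of_forall fun x => ?_)
  rw [norm_smul, Real.norm_of_nonneg (Real.sqrt_nonneg _)]
  gcongr
  exact twoPhase_le_max x

theorem MemLp.inv_sqrt_twoPhase_smul {μ : Measure (Space N)} (hc : 0 < σc) (hs : 0 < σs)
    (hD : MeasurableSet D) {a : Space N → Space N} (ha : MemLp a 2 μ) :
    MemLp (fun x => (√(twoPhase σc σs D x))⁻¹ • a x) 2 μ := by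
  have hm : 0 < min σc σs := lt_min hc hs
  refine ha.of_le_mul (c := (√(min σc σs))⁻¹)
    ((measurable_twoPhase hD).sqrt.inv.aestronglyMeasurable.smul ha.1)
    (Eventually.of_forall fun x => ?_)
  rw [norm_smul, norm_inv, Real.norm_of_nonneg (Real.sqrt_nonneg _)]
  gcongr
  exact min_le_twoPhase x

theorem norm_le_inv_sqrt_min_mul (hc : 0 < σc) (hs : 0 < σs) (x : Space N) (v w : Space N)
    (h : w = √(twoPhase σc σs D x) • v) : ‖v‖ ≤ (√(min σc σs))⁻¹ * ‖w‖ := by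
  have hm : 0 < √(min σc σs) := Real.sqrt_pos.2 (lt_min hc hs)
  rw [h, norm_smul, Real.norm_of_nonneg (Real.sqrt_nonneg _), inv_mul_eq_div, le_div_iff₀ hm,
    mul_comm]
  gcongr
  exact min_le_twoPhase x

/-- The fields `√σ ∇φ`, with `φ` a test function, as a subspace of `L²`. -/
def weightedGradients (σc σs : ℝ) (D Ω : Set (Space N)) :
    Submodule ℝ (Lp (Space N) 2 (volume.restrict Ω)) where
  carrier := {h | ∃ φ, IsTestFunction Ω φ ∧
    h =ᵐ[volume.restrict Ω] fun x => √(twoPhase σc σs D x) • gradient φ x}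
  zero_mem' := by
    refine ⟨0, IsTestFunction.zero, ?_⟩
    filter_upwards [Lp.coeFn_zero (Space N) 2 (volume.restrict Ω)] with x hx
    rw [hx]
    simp [gradient]
  add_mem' := by
    rintro h h' ⟨φ, hφ, e⟩ ⟨φ', hφ', e'⟩
    refine ⟨φ + φ', hφ.add hφ', ?_⟩
    filter_upwards [e, e', Lp.coeFn_add h h'] with x h1 h2 h3
    rw [h3, Pi.add_apply, h1, h2, gradient_add_fun hφ.contDiff_one hφ'.contDiff_one,
      Pi.add_apply, smul_add]
  smul_mem' := by
    rintro c h ⟨φ, hφ, e⟩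
    refine ⟨c • φ, hφ.const_smul c, ?_⟩
    filter_upwards [e, Lp.coeFn_smul c h] with x h1 h3
    rw [h3, Pi.smul_apply, h1, gradient_smul_fun hφ.contDiff_one, Pi.smul_apply, smul_comm]

/-- Since `σ` is bounded below, convergence of `√σ ∇φₙ` forces convergence of `∇φₙ`. Poincaré then
makes `φₙ` Cauchy in `L²`, and completeness supplies the function. -/
theorem exists_memH10_of_mem_closure (hN : N ≠ 0) (hc : 0 < σc) (hs : 0 < σs)
    (hD : MeasurableSet D) (hρ0 : 0 ≤ ρ) (hρ : ∀ x ∈ Ω, ‖x‖ ≤ ρ)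
    {h : Lp (Space N) 2 (volume.restrict Ω)}
    (hh : h ∈ (weightedGradients σc σs D Ω).topologicalClosure) :
    ∃ u, MemH10 Ω u fun x => (√(twoPhase σc σs D x))⁻¹ • h x := by
  have hσ : ∀ x, 0 < √(twoPhase σc σs D x) := fun x => Real.sqrt_pos.2 (twoPhase_pos hc hs x)
  obtain ⟨k, hk, hlim⟩ := mem_closure_iff_seq_limit.1 hh
  choose φ hφ hkφ using hk
  have hg := MemLp.inv_sqrt_twoPhase_smul hc hs hD (Lp.memLp h)
  have hgrad : Tendsto (fun n => eLpNorm
      (gradient (φ n) - fun x => (√(twoPhase σc σs D x))⁻¹ • h x) 2 (volume.restrict Ω)) atTop (𝓝 0) := by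
    have l := ENNReal.Tendsto.const_mul (a := ENNReal.ofReal (√(min σc σs))⁻¹)
      ((Lp.tendsto_Lp_iff_tendsto_eLpNorm' _ _).1 hlim) (Or.inr ENNReal.ofReal_ne_top)
    rw [mul_zero] at l
    refine tendsto_of_tendsto_of_tendsto_of_le_of_le tendsto_const_nhds l (fun _ => zero_le)
      fun n => eLpNorm_le_mul_eLpNorm_of_ae_le_mul ?_ _
    filter_upwards [hkφ n] with x hx
    refine norm_le_inv_sqrt_min_mul (D := D) hc hs x _ _ ?_
    rw [Pi.sub_apply, hx, Pi.sub_apply, smul_sub, smul_inv_smul₀ (hσ x).ne']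
  set C : NNReal := Real.toNNReal (2 * ρ / N) * Real.toNNReal (√(min σc σs))⁻¹ with hC
  have hedist : ∀ n m, edist ((hφ n).memLp.toLp (φ n)) ((hφ m).memLp.toLp (φ m)) ≤
      C * edist (k n) (k m) := by
    intro n m
    have ht := (hφ n).sub (hφ m)
    rw [Lp.edist_toLp_toLp, Lp.edist_def]
    refine (eLpNorm_le_eLpNorm_gradient hN hρ0 hρ ht.contDiff_one ht.2.1 ht.2.2).trans ?_
    rw [hC, ENNReal.coe_mul, mul_assoc]
    refine mul_le_mul_right (eLpNorm_le_mul_eLpNorm_of_ae_le_mul ?_ _) _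
    filter_upwards [hkφ n, hkφ m] with x hx hx'
    refine norm_le_inv_sqrt_min_mul (D := D) hc hs x _ _ ?_
    rw [Pi.sub_apply, hx, hx', gradient_sub_fun (hφ n).contDiff_one (hφ m).contDiff_one,
      Pi.sub_apply, smul_sub]
  have hcau : CauchySeq fun n => (hφ n).memLp.toLp (φ n) := by
    have hkc := Metric.cauchySeq_iff.1 hlim.cauchySeq
    refine Metric.cauchySeq_iff.2 fun ε hε => ?_
    -- `C + 1` rather than `C`, since `C` may be zero.
    obtain ⟨M, hM⟩ := hkc (ε / (C + 1)) (by positivity)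
    refine ⟨M, fun m hm n hn => ?_⟩
    have h1 : dist ((hφ m).memLp.toLp (φ m)) ((hφ n).memLp.toLp (φ n)) ≤
        C * dist (k m) (k n) := by
      have := hedist m n
      rw [edist_nndist, edist_nndist] at this
      exact_mod_cast this
    have h2 := hM m hm n hn
    rw [lt_div_iff₀ (by positivity)] at h2
    have h3 : 0 ≤ dist (k m) (k n) := dist_nonneg
    nlinarith
  obtain ⟨U, hU⟩ := cauchySeq_tendsto_of_complete hcau
  refine ⟨U, MemH10.of_tendsto (Lp.memLp U) hg hφ ?_ hgrad⟩
  rw [← Lp.toLp_coeFn U (Lp.memLp U)] at hU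
  exact (Lp.tendsto_Lp_iff_tendsto_eLpNorm'' _ (fun n => (hφ n).memLp) _ (Lp.memLp U)).1 hU

/-- The weight `√σ` turns the energy product into that of `L²`. The solution's gradient is then the
orthogonal projection of `p` onto gradients: orthogonality of the residual is the weak equation,
because `p` is an admissible flux. -/
theorem exists_isWeakSolution (hN : N ≠ 0) (hc : 0 < σc) (hs : 0 < σs)
    (hD : MeasurableSet D) (hΩ : MeasurableSet Ω) [IsFiniteMeasure (volume.restrict Ω)]
    (hρ0 : 0 ≤ ρ) (hρ : ∀ x ∈ Ω, ‖x‖ ≤ ρ) :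
    ∃ (u : Space N → ℝ) (g : Space N → Space N), IsWeakSolution σc σs D Ω u g := by
  have hp := memLp_dualField hN hc hs hD hΩ hρ
  have hq := MemLp.sqrt_twoPhase_smul (σc := σc) (σs := σs) hD hp
  set K := (weightedGradients σc σs D Ω).topologicalClosure
  set h := K.starProjection (hq.toLp _) with hh
  have hσ : ∀ x, 0 < √(twoPhase σc σs D x) := fun x => Real.sqrt_pos.2 (twoPhase_pos hc hs x)
  obtain ⟨u, hu⟩ := exists_memH10_of_mem_closure hN hc hs hD hρ0 hρ
    (K.starProjection_apply_mem (hq.toLp _))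
  rw [← hh] at hu
  refine ⟨u, _, hu, fun ψ ζ hψ => ?_⟩
  have key : ∀ φ, IsTestFunction Ω φ →
      ∫ x in Ω, inner ℝ (twoPhase σc σs D x • (√(twoPhase σc σs D x))⁻¹ • h x) (gradient φ x) =
      ∫ x in Ω, inner ℝ (twoPhase σc σs D x • dualField σc σs D x) (gradient φ x) := by
    intro φ hφ
    have hw := MemLp.sqrt_twoPhase_smul (σc := σc) (σs := σs) hD hφ.memLp_gradient
    have h0 := K.starProjection_inner_eq_zero (hq.toLp _) (hw.toLp _)
      (Submodule.le_topologicalClosure _ ⟨φ, hφ, hw.coeFn_toLp⟩)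
    rw [inner_sub_left, sub_eq_zero, ← hh, inner_toLp_toLp,
      ← Lp.toLp_coeFn h (Lp.memLp h), inner_toLp_toLp] at h0
    have e : ∀ x, √(twoPhase σc σs D x) * √(twoPhase σc σs D x) = twoPhase σc σs D x :=
      fun x => Real.mul_self_sqrt (twoPhase_pos hc hs x).le
    calc _ = ∫ x in Ω, inner ℝ (h x) (√(twoPhase σc σs D x) • gradient φ x) := by
          congr 1
          funext x
          rw [smul_smul, real_inner_smul_left, real_inner_smul_right]
          congr 1
          rw [← div_eq_mul_inv, div_eq_iff (hσ x).ne', e]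
      _ = _ := h0.symm
      _ = _ := by
          congr 1
          funext x
          simp only [real_inner_smul_left, real_inner_smul_right]
          rw [← mul_assoc, e]
  -- The equation is known against test functions and extends to `H¹₀` by density.
  obtain ⟨φ, hφ, h1, h2⟩ := hψ.approx
  have l1 := tendsto_integral_inner (MemLp.twoPhase_smul hc hs hD hu.memLp_grad)
    (fun n => (hφ n).memLp_gradient) hψ.memLp_grad h2
  have l2 := tendsto_integral_inner (MemLp.twoPhase_smul hc hs hD hp)
    (fun n => (hφ n).memLp_gradient) hψ.memLp_grad h2
  simp only [key _ (hφ _)] at l1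
  rw [← hψ.integral_twoPhase_mul_inner_dualField hN hc hs hD hΩ hρ]
  simpa only [real_inner_smul_left] using tendsto_nhds_unique l1 l2

theorem wellPosed (hN : N ≠ 0) (hc : 0 < σc) (hs : 0 < σs)
    (hD : MeasurableSet D) (hΩ : MeasurableSet Ω) [IsFiniteMeasure (volume.restrict Ω)]
    (hρ0 : 0 ≤ ρ) (hρ : ∀ x ∈ Ω, ‖x‖ ≤ ρ) : WellPosed σc σs D Ω := by
  obtain ⟨u, g, h⟩ := exists_isWeakSolution hN hc hs hD hΩ hρ0 hρ
  exact ⟨u, g, h, fun u' g' h' => h.ae_eq hN hc hs hD hρ0 hρ h'⟩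

theorem exists_torsionalRigidity_eq (h : WellPosed σc σs D Ω) :
    ∃ (u : Space N → ℝ) (g : Space N → Space N), IsWeakSolution σc σs D Ω u g ∧
      torsionalRigidity σc σs D Ω = ∫ x in Ω, twoPhase σc σs D x * ‖g x‖ ^ 2 := by
  obtain ⟨u, g, hu, -⟩ := h
  have hex : ∃ p : (Space N → ℝ) × (Space N → Space N),
      IsWeakSolution σc σs D Ω p.1 p.2 := ⟨(u, g), hu⟩
  refine ⟨hex.choose.1, hex.choose.2, hex.choose_spec, ?_⟩
  rw [torsionalRigidity, dif_pos hex]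

end Existence


/-! ### Small perturbations of the identity -/

section Perturbation

variable {N : ℕ}

theorem C2Bounded.norm_apply_le (Ψ : C2Bounded (Space N)) (x : Space N) : ‖Ψ x‖ ≤ ‖Ψ‖ :=
  (le_supNorm Ψ.2.2.1 x).trans (le_max_left _ _)

theorem C2Bounded.norm_fderiv_le (Ψ : C2Bounded (Space N)) (x : Space N) :
    ‖fderiv ℝ (⇑Ψ) x‖ ≤ ‖Ψ‖ :=
  (le_supNorm Ψ.2.2.2.1 x).trans ((le_max_left _ _).trans (le_max_right _ _))

/-- `S` is a `C¹` inverse of `Id + Ψ`. -/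
structure IsInverse (Ψ : C2Bounded (Space N)) (S : Space N → Space N) : Prop where
  contDiff : ContDiff ℝ 1 S
  right_inv : ∀ x, S x + Ψ (S x) = x
  left_inv : ∀ y, S (y + Ψ y) = y

/-- `Ψ` is `1/2`-Lipschitz, so `Id + Ψ` is a homeomorphism. Its derivative is invertible by the
Neumann series, which makes the inverse `C¹`. -/
theorem exists_isInverse (Ψ : C2Bounded (Space N)) (h : ‖Ψ‖ ≤ 1 / 2) : ∃ S, IsInverse Ψ S := by
  have hd : Differentiable ℝ (⇑Ψ) := Ψ.contDiff.differentiable (by norm_num)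
  have hlip : LipschitzWith (1 / 2) (⇑Ψ) :=
    lipschitzWith_of_nnnorm_fderiv_le hd fun x => by
      have := (Ψ.norm_fderiv_le x).trans h
      rw [← NNReal.coe_le_coe]
      simpa using this
  have happ : ApproximatesLinearOn (fun x => x + Ψ x)
      ((ContinuousLinearEquiv.refl ℝ (Space N) : Space N ≃L[ℝ] Space N) :
        Space N →L[ℝ] Space N) Set.univ (1 / 2) := by
    intro x _ y _
    have := hlip.dist_le_mul x y
    rw [dist_eq_norm, dist_eq_norm] at this
    simpa [add_sub_add_comm] using this
  have hcond : Subsingleton (Space N) ∨ (1 / 2 : NNReal) <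
      ‖((ContinuousLinearEquiv.refl ℝ (Space N)).symm : Space N →L[ℝ] Space N)‖₊⁻¹ := by
    -- The identity has norm `1` only on a nontrivial space, hence the separate case.
    rcases subsingleton_or_nontrivial (Space N) with hsub | hnon
    · exact Or.inl hsub
    · right
      have : ‖((ContinuousLinearEquiv.refl ℝ (Space N)).symm : Space N →L[ℝ] Space N)‖₊ = 1 :=
        NNReal.eq ContinuousLinearMap.norm_id
      rw [this, inv_one, ← NNReal.coe_lt_coe]
      norm_num
  set T := happ.toHomeomorph _ hcond
  have hT : ∀ x, T x = x + Ψ x := fun x => rfl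
  have hinv : ∀ a, ∃ e : Space N ≃L[ℝ] Space N,
      HasFDerivAt T (e : Space N →L[ℝ] Space N) a := by
    intro a
    have hlt : ‖-fderiv ℝ (⇑Ψ) a‖ < 1 := by
      rw [norm_neg]
      linarith [Ψ.norm_fderiv_le a]
    refine ⟨ContinuousLinearEquiv.unitsEquiv ℝ (Space N) (Units.oneSub _ hlt), ?_⟩
    have hE : (ContinuousLinearEquiv.unitsEquiv ℝ (Space N) (Units.oneSub _ hlt) :
        Space N →L[ℝ] Space N) = .id ℝ (Space N) + fderiv ℝ (⇑Ψ) a := by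
      ext1 v
      rw [ContinuousLinearEquiv.coe_coe, ContinuousLinearEquiv.unitsEquiv_apply, Units.val_oneSub,
        sub_neg_eq_add]
      rfl
    rw [hE]
    exact (hasFDerivAt_id a).add (hd a).hasFDerivAt
  choose e he using hinv
  refine ⟨T.symm, T.contDiff_symm he ?_, fun x => ?_, fun y => ?_⟩
  · exact contDiff_id.add (Ψ.contDiff.of_le (by norm_num))
  · rw [← hT, T.apply_symm_apply]
  · rw [← hT, T.symm_apply_apply]

namespace IsInverse

variable {Ψ : C2Bounded (Space N)} {S : Space N → Space N}

theorem image_eq_preimage (hS : IsInverse Ψ S) (ω : Set (Space N)) :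
    (fun x => x + Ψ x) '' ω = S ⁻¹' ω := by
  ext x
  constructor
  · rintro ⟨y, hy, rfl⟩
    rw [Set.mem_preimage, hS.left_inv]
    exact hy
  · exact fun hx => ⟨S x, hx, hS.right_inv x⟩

theorem norm_sub_le (hS : IsInverse Ψ S) (x : Space N) : ‖x - S x‖ ≤ ‖Ψ‖ := by
  have : x - S x = Ψ (S x) := by
    rw [sub_eq_iff_eq_add']
    exact (hS.right_inv x).symm
  rw [this]
  exact Ψ.norm_apply_le _

theorem preimage_ball_subset (hS : IsInverse Ψ S) (r : ℝ) :
    S ⁻¹' Metric.ball 0 r ⊆ Metric.ball 0 (r + ‖Ψ‖) := by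
  intro x hx
  rw [Set.mem_preimage, mem_ball_zero_iff] at hx
  rw [mem_ball_zero_iff]
  have := norm_add_le (x - S x) (S x)
  rw [sub_add_cancel] at this
  linarith [hS.norm_sub_le x]

theorem ball_subset_preimage (hS : IsInverse Ψ S) (r : ℝ) :
    Metric.ball 0 (r - ‖Ψ‖) ⊆ S ⁻¹' Metric.ball 0 r := by
  intro x hx
  rw [mem_ball_zero_iff] at hx
  rw [Set.mem_preimage, mem_ball_zero_iff]
  have := _root_.norm_sub_le x (x - S x)
  rw [sub_sub_cancel] at this
  linarith [hS.norm_sub_le x]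

theorem fderiv_add (hS : IsInverse Ψ S) (x : Space N) :
    fderiv ℝ S x + (fderiv ℝ (⇑Ψ) (S x)).comp (fderiv ℝ S x) = .id ℝ (Space N) := by
  have hd : HasFDerivAt S (fderiv ℝ S x) x :=
    (hS.contDiff.differentiable (by norm_num) x).hasFDerivAt
  have hΨ : HasFDerivAt (⇑Ψ) (fderiv ℝ (⇑Ψ) (S x)) (S x) :=
    (Ψ.contDiff.differentiable (by norm_num) (S x)).hasFDerivAt
  have h1 := hd.add (hΨ.comp x hd)
  have h2 : (S + ⇑Ψ ∘ S) = id := funext hS.right_inv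
  rw [h2] at h1
  exact h1.unique (hasFDerivAt_id x)

/-- From `DS = Id - DΨ(S) DS`, the norm `a` of `DS` satisfies `a ≤ 1 + a/2`. -/
theorem norm_fderiv_le (hS : IsInverse Ψ S) (h : ‖Ψ‖ ≤ 1 / 2) (x : Space N) :
    ‖fderiv ℝ S x‖ ≤ 2 := by
  have h1 := hS.fderiv_add x
  rw [← eq_sub_iff_add_eq] at h1
  have h2 : ‖fderiv ℝ S x‖ ≤ 1 + ‖Ψ‖ * ‖fderiv ℝ S x‖ := by
    calc ‖fderiv ℝ S x‖ = ‖.id ℝ (Space N) - (fderiv ℝ (⇑Ψ) (S x)).comp (fderiv ℝ S x)‖ := by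
          rw [← h1]
      _ ≤ _ := (_root_.norm_sub_le _ _).trans (add_le_add ContinuousLinearMap.norm_id_le
          ((ContinuousLinearMap.opNorm_comp_le _ _).trans (by gcongr; exact Ψ.norm_fderiv_le _)))
  nlinarith [norm_nonneg (fderiv ℝ S x)]

theorem norm_id_sub_fderiv_le (hS : IsInverse Ψ S) (h : ‖Ψ‖ ≤ 1 / 2) (x : Space N) :
    ‖.id ℝ (Space N) - fderiv ℝ S x‖ ≤ 2 * ‖Ψ‖ := by
  rw [← hS.fderiv_add x, add_sub_cancel_left]
  refine (ContinuousLinearMap.opNorm_comp_le _ _).trans ?_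
  rw [mul_comm]
  exact mul_le_mul (hS.norm_fderiv_le h x) (Ψ.norm_fderiv_le _) (norm_nonneg _) zero_le_two

theorem norm_adjoint_le (hS : IsInverse Ψ S) (h : ‖Ψ‖ ≤ 1 / 2) {x : Space N} (hx : ‖S x‖ ≤ 1) :
    ‖(fderiv ℝ S x).adjoint (S x)‖ ≤ 2 := by
  refine (ContinuousLinearMap.le_opNorm _ _).trans ?_
  rw [LinearIsometryEquiv.norm_map]
  nlinarith [hS.norm_fderiv_le h x, norm_nonneg (fderiv ℝ S x), norm_nonneg (S x)]

/-- Split as `(x - S x) + (Id - DS)ᵀ S x`, with bounds `‖Ψ‖` and `2‖Ψ‖`. Up to a scalar this vector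
is the gap between the dual field and the transported gradient, so the quadratic defect rests on it.
-/
theorem norm_sub_adjoint_le (hS : IsInverse Ψ S) (h : ‖Ψ‖ ≤ 1 / 2) {x : Space N}
    (hx : ‖S x‖ ≤ 1) : ‖x - (fderiv ℝ S x).adjoint (S x)‖ ≤ 3 * ‖Ψ‖ := by
  have e : x - (fderiv ℝ S x).adjoint (S x) =
      (x - S x) + (ContinuousLinearMap.adjoint (.id ℝ (Space N) - fderiv ℝ S x)) (S x) := by
    rw [map_sub, sub_apply]
    have : ContinuousLinearMap.adjoint (.id ℝ (Space N)) = .id ℝ (Space N) :=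
      ContinuousLinearMap.adjoint_id
    rw [this, ContinuousLinearMap.id_apply, sub_add_sub_cancel]
  rw [e]
  have h1 : ‖(ContinuousLinearMap.adjoint (.id ℝ (Space N) - fderiv ℝ S x)) (S x)‖ ≤ 2 * ‖Ψ‖ := by
    refine (ContinuousLinearMap.le_opNorm _ _).trans ?_
    rw [LinearIsometryEquiv.norm_map]
    nlinarith [hS.norm_id_sub_fderiv_le h x,
      norm_nonneg (.id ℝ (Space N) - fderiv ℝ S x), norm_nonneg (S x), norm_nonneg Ψ]
  linarith [norm_add_le (x - S x)
    ((ContinuousLinearMap.adjoint (.id ℝ (Space N) - fderiv ℝ S x)) (S x)), hS.norm_sub_le x]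

end IsInverse

end Perturbation

/-! ### Transported radial competitors -/

section Competitors

variable {N : ℕ}

theorem gradient_comp_norm_sq {F F' : ℝ → ℝ} (hF : ∀ s, HasDerivAt F (F' s) s)
    {S : Space N → Space N} {x : Space N} (hS : DifferentiableAt ℝ S x) :
    gradient (fun y => F (‖S y‖ ^ 2)) x =
      (2 * F' (‖S x‖ ^ 2)) • (fderiv ℝ S x).adjoint (S x) := by
  refine ext_inner_right ℝ fun v => ?_
  have := (hF (‖S x‖ ^ 2)).comp_hasFDerivAt x hS.hasFDerivAt.norm_sq
  rw [inner_gradient]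
  change fderiv ℝ (F ∘ fun y => ‖S y‖ ^ 2) x v = _
  rw [this.fderiv, real_inner_smul_left, ContinuousLinearMap.adjoint_inner_left]
  simp
  ring

/-- The truncation to the unit interval. -/
def unitClamp (s : ℝ) : ℝ := max 0 (min 1 s)

theorem continuous_unitClamp : Continuous unitClamp :=
  continuous_const.max (continuous_const.min continuous_id)

theorem unitClamp_nonneg (s : ℝ) : 0 ≤ unitClamp s := le_max_left _ _

theorem unitClamp_le_one (s : ℝ) : unitClamp s ≤ 1 := max_le zero_le_one (min_le_left _ _)

theorem unitClamp_of_nonpos {s : ℝ} (hs : s ≤ 0) : unitClamp s = 0 :=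
  max_eq_left ((min_le_right _ _).trans hs)

theorem unitClamp_of_one_le {s : ℝ} (hs : 1 ≤ s) : unitClamp s = 1 := by
  rw [unitClamp, min_eq_left hs, max_eq_right zero_le_one]

theorem eventually_unitClamp_eq_one {a : ℝ} (ha : 0 < a) (b : ℝ) :
    ∀ᶠ n : ℕ in atTop, unitClamp (((n : ℝ) + 1) * a - b) = 1 := by
  obtain ⟨M, hM⟩ := exists_nat_gt ((1 + b) / a)
  filter_upwards [eventually_ge_atTop M] with n hn
  apply unitClamp_of_one_le
  rw [div_lt_iff₀ ha] at hM
  have : (M : ℝ) ≤ n := by exact_mod_cast hn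
  nlinarith

/-- Continuous approximations of `σ⁻¹` on the unit ball, as functions of `s = |x|²`, that vanish
for `s` close to `1`. -/
def approxInv (σc σs R : ℝ) (n : ℕ) (s : ℝ) : ℝ :=
  (σs⁻¹ + (σc⁻¹ - σs⁻¹) * unitClamp (((n : ℝ) + 1) * (R ^ 2 - s))) *
    unitClamp (((n : ℝ) + 1) * (1 - s) - 1)

variable {σc σs R : ℝ}

theorem continuous_approxInv (n : ℕ) : Continuous (approxInv σc σs R n) := by
  unfold approxInv
  exact (continuous_const.add (continuous_const.mul (continuous_unitClamp.comp (by fun_prop)))).mul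
    (continuous_unitClamp.comp (by fun_prop))

theorem abs_approxInv_le (n : ℕ) (s : ℝ) :
    |approxInv σc σs R n s| ≤ |σs⁻¹| + |σc⁻¹ - σs⁻¹| := by
  rw [approxInv, abs_mul, abs_of_nonneg (unitClamp_nonneg (((n : ℝ) + 1) * (1 - s) - 1))]
  refine (mul_le_of_le_one_right (abs_nonneg _) (unitClamp_le_one _)).trans ?_
  refine (abs_add_le _ _).trans ?_
  rw [abs_mul, abs_of_nonneg (unitClamp_nonneg (((n : ℝ) + 1) * (R ^ 2 - s)))]
  gcongr
  exact mul_le_of_le_one_right (abs_nonneg _) (unitClamp_le_one _)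

/-- The shift by `-1` in the second cutoff switches it off before `s` reaches `1`; this gives the
competitor compact support in the open domain. -/
theorem approxInv_eq_zero {n : ℕ} {s : ℝ} (hs : 1 - 1 / ((n : ℝ) + 1) ≤ s) :
    approxInv σc σs R n s = 0 := by
  suffices h : unitClamp (((n : ℝ) + 1) * (1 - s) - 1) = 0 by rw [approxInv, h, mul_zero]
  apply unitClamp_of_nonpos
  have hn : (0 : ℝ) < n + 1 := by positivity
  have : (n + 1 : ℝ) * (1 - s) ≤ (n + 1) * (1 / (n + 1)) := by
    gcongr
    linarith
  rw [mul_one_div_cancel hn.ne'] at this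
  linarith

/-- For fixed `s` both cutoffs are eventually constant. At `s = R²` the first one is `0`, in
agreement with the core being the open ball. -/
theorem tendsto_approxInv {s : ℝ} (hs : s < 1) :
    Tendsto (fun n => approxInv σc σs R n s) atTop
      (𝓝 (if s < R ^ 2 then σc⁻¹ else σs⁻¹)) := by
  refine tendsto_const_nhds.congr' ?_
  have h1 := eventually_unitClamp_eq_one (sub_pos.2 hs) 1
  split_ifs with h
  · have h2 := eventually_unitClamp_eq_one (sub_pos.2 h) 0
    filter_upwards [h1, h2] with n e1 e2
    rw [sub_zero] at e2
    rw [approxInv, e1, e2]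
    ring
  · filter_upwards [h1] with n e1
    rw [approxInv, e1, unitClamp_of_nonpos]
    · ring
    · have : R ^ 2 - s ≤ 0 := by linarith
      exact mul_nonpos_of_nonneg_of_nonpos (by positivity) this

/-- The radial profile with derivative `-(2N)⁻¹ approxInv`. -/
def radialProfile (N : ℕ) (σc σs R : ℝ) (n : ℕ) (s : ℝ) : ℝ :=
  ∫ τ in (1 : ℝ)..s, -(2 * N : ℝ)⁻¹ * approxInv σc σs R n τ

theorem hasDerivAt_radialProfile (n : ℕ) (s : ℝ) :
    HasDerivAt (radialProfile N σc σs R n) (-(2 * N : ℝ)⁻¹ * approxInv σc σs R n s) s :=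
  ((continuous_const.mul (continuous_approxInv n)).integral_hasStrictDerivAt 1 s).hasDerivAt

theorem contDiff_radialProfile (n : ℕ) : ContDiff ℝ 1 (radialProfile N σc σs R n) := by
  rw [contDiff_one_iff_deriv]
  refine ⟨fun s => (hasDerivAt_radialProfile n s).differentiableAt, ?_⟩
  have : deriv (radialProfile N σc σs R n) = fun s => -(2 * N : ℝ)⁻¹ * approxInv σc σs R n s :=
    funext fun s => (hasDerivAt_radialProfile n s).deriv
  rw [this]
  exact continuous_const.mul (continuous_approxInv n)

theorem radialProfile_eq_zero {n : ℕ} {s : ℝ} (hs : 1 - 1 / ((n : ℝ) + 1) ≤ s) :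
    radialProfile N σc σs R n s = 0 := by
  have h1 : 1 - 1 / ((n : ℝ) + 1) ≤ 1 := by
    have : (0 : ℝ) < 1 / (n + 1) := by positivity
    linarith
  refine intervalIntegral.integral_zero_ae (Eventually.of_forall fun τ hτ => ?_)
  rw [approxInv_eq_zero, mul_zero]
  exact (le_inf h1 hs).trans hτ.1.le

/-- The competitor `F_n(|S x|²)`. -/
def competitor (σc σs R : ℝ) (S : Space N → Space N) (n : ℕ) (x : Space N) : ℝ :=
  radialProfile N σc σs R n (‖S x‖ ^ 2)

variable {Ψ : C2Bounded (Space N)} {S : Space N → Space N}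

theorem contDiff_competitor (hS : IsInverse Ψ S) (n : ℕ) :
    ContDiff ℝ 1 (competitor σc σs R S n) :=
  (contDiff_radialProfile n).comp (hS.contDiff.norm_sq ℝ)

/-- The `2` from differentiating `‖S x‖²` cancels the one in `(2N)⁻¹`. -/
theorem gradient_competitor (hS : IsInverse Ψ S) (n : ℕ) (x : Space N) :
    gradient (competitor σc σs R S n) x =
      -((N : ℝ)⁻¹ * approxInv σc σs R n (‖S x‖ ^ 2)) • (fderiv ℝ S x).adjoint (S x) := by
  refine (gradient_comp_norm_sq (hasDerivAt_radialProfile n)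
    (hS.contDiff.differentiable (by norm_num) x)).trans ?_
  congr 1
  rw [mul_inv]
  ring

theorem tsupport_competitor_subset (hS : IsInverse Ψ S) (n : ℕ) :
    tsupport (competitor σc σs R S n) ⊆ S ⁻¹' {y | ‖y‖ ^ 2 ≤ 1 - 1 / ((n : ℝ) + 1)} := by
  refine closure_minimal (fun x hx => ?_)
    ((isClosed_le (continuous_norm.pow 2) continuous_const).preimage hS.contDiff.continuous)
  by_contra h
  exact hx (radialProfile_eq_zero (not_le.1 h).le)

theorem tsupport_competitor_subset_preimage_ball (hS : IsInverse Ψ S) (n : ℕ) :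
    tsupport (competitor σc σs R S n) ⊆ S ⁻¹' Metric.ball 0 1 := by
  refine (tsupport_competitor_subset hS n).trans (Set.preimage_mono fun y hy => ?_)
  have : (0 : ℝ) < 1 / (n + 1) := by positivity
  change ‖y‖ ^ 2 ≤ 1 - 1 / ((n : ℝ) + 1) at hy
  rw [mem_ball_zero_iff]
  nlinarith [norm_nonneg y]

theorem hasCompactSupport_competitor (hS : IsInverse Ψ S) (n : ℕ) :
    HasCompactSupport (competitor σc σs R S n) :=
  Metric.isCompact_of_isClosed_isBounded (isClosed_tsupport _)
    (Metric.isBounded_ball.subset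
      ((tsupport_competitor_subset_preimage_ball hS n).trans (hS.preimage_ball_subset 1)))

end Competitors


/-! ### The energy of perturbed balls -/

section Defect

variable {N : ℕ} {σc σs R : ℝ} {Ψ : C2Bounded (Space N)} {S : Space N → Space N}

theorem IsInverse.measurableSet_preimage_ball (hS : IsInverse Ψ S) (r : ℝ) :
    MeasurableSet (S ⁻¹' Metric.ball 0 r) :=
  (Metric.isOpen_ball.preimage hS.contDiff.continuous).measurableSet

theorem IsInverse.isFiniteMeasure_restrict (hS : IsInverse Ψ S) (r : ℝ) :
    IsFiniteMeasure ((volume : Measure (Space N)).restrict (S ⁻¹' Metric.ball 0 r)) :=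
  MeasureTheory.isFiniteMeasure_restrict.2
    ((measure_mono (hS.preimage_ball_subset r)).trans_lt measure_ball_lt_top).ne

theorem IsInverse.norm_le_two (hS : IsInverse Ψ S) (h : ‖Ψ‖ ≤ 1 / 2) :
    ∀ x ∈ S ⁻¹' Metric.ball 0 1, ‖x‖ ≤ 2 := fun x hx => by
  have := mem_ball_zero_iff.1 (hS.preimage_ball_subset 1 hx)
  linarith

theorem inv_twoPhase_preimage_ball (hR : 0 < R) (S : Space N → Space N) (x : Space N) :
    (twoPhase σc σs (S ⁻¹' Metric.ball 0 R) x)⁻¹ =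
      if ‖S x‖ ^ 2 < R ^ 2 then σc⁻¹ else σs⁻¹ := by
  have : x ∈ S ⁻¹' Metric.ball 0 R ↔ ‖S x‖ ^ 2 < R ^ 2 := by
    rw [Set.mem_preimage, mem_ball_zero_iff, sq_lt_sq₀ (norm_nonneg _) hR.le]
  unfold twoPhase
  simp only [this]
  split_ifs <;> rfl

/-- Dominated convergence on a domain of finite measure. Passing to the limit in the defects avoids
showing that the limiting competitor lies in `H¹₀`. -/
theorem tendsto_defect (hN : N ≠ 0) (hR : 0 < R) (hc : 0 < σc) (hs : 0 < σs) (h : ‖Ψ‖ ≤ 1 / 2)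
    (hS : IsInverse Ψ S) {D : Set (Space N)} (hD : D = S ⁻¹' Metric.ball 0 R) :
    Tendsto (fun n => ∫ x in S ⁻¹' Metric.ball 0 1, twoPhase σc σs D x *
        ‖dualField σc σs D x - gradient (competitor σc σs R S n) x‖ ^ 2) atTop
      (𝓝 (∫ x in S ⁻¹' Metric.ball 0 1, twoPhase σc σs D x *
        ‖dualField σc σs D x +
          (N * twoPhase σc σs D x)⁻¹ • (fderiv ℝ S x).adjoint (S x)‖ ^ 2)) := by
  have hDm : MeasurableSet D := hD ▸ hS.measurableSet_preimage_ball R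
  have hΩm := hS.measurableSet_preimage_ball 1
  have := hS.isFiniteMeasure_restrict 1
  have hm : 0 < min σc σs := lt_min hc hs
  refine tendsto_integral_of_dominated_convergence
    -- The factors `2` come from `‖x‖ ≤ 2` and `‖DSᵀ S x‖ ≤ 2`; the bound on `approxInv` is uniform
    -- in `n`.
    (fun _ => max σc σs * ((N * min σc σs)⁻¹ * 2 +
      (N : ℝ)⁻¹ * (|σs⁻¹| + |σc⁻¹ - σs⁻¹|) * 2) ^ 2) (fun n => ?_) (integrable_const _)
    (fun n => ?_) ?_
  · exact ((measurable_twoPhase hDm).mul (((measurable_dualField hDm).sub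
      (continuous_gradient (contDiff_competitor hS n)).measurable).norm.pow_const 2)).aestronglyMeasurable
  · filter_upwards [ae_restrict_mem hΩm] with x hx
    have hx1 : ‖S x‖ ≤ 1 := (mem_ball_zero_iff.1 hx).le
    rw [norm_mul, Real.norm_of_nonneg (twoPhase_pos hc hs x).le, norm_pow, norm_norm]
    gcongr
    · exact twoPhase_le_max x
    · refine (_root_.norm_sub_le _ _).trans (add_le_add ?_ ?_)
      · refine (norm_dualField_le hN hc hs x).trans ?_
        gcongr
        exact hS.norm_le_two h x hx
      · rw [gradient_competitor hS, norm_smul, norm_neg, norm_mul, norm_inv, Real.norm_natCast]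
        gcongr
        · exact abs_approxInv_le n _
        · exact hS.norm_adjoint_le h hx1
  · filter_upwards [ae_restrict_mem hΩm] with x hx
    have hx1 : ‖S x‖ < 1 := mem_ball_zero_iff.1 hx
    have hx2 : ‖S x‖ ^ 2 < 1 := by nlinarith [norm_nonneg (S x)]
    have l := tendsto_approxInv (σc := σc) (σs := σs) (R := R) hx2
    rw [← inv_twoPhase_preimage_ball hR, ← hD] at l
    have l2 := (((l.const_mul (N : ℝ)⁻¹).neg.smul_const
      ((fderiv ℝ S x).adjoint (S x))).const_sub (dualField σc σs D x)).norm.pow 2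
      |>.const_mul (twoPhase σc σs D x)
    simp only [gradient_competitor hS]
    rw [neg_smul, sub_neg_eq_add, ← mul_inv] at l2
    exact l2

/-- The vector inside the norm is `-(Nσ)⁻¹ (x - DSᵀ S x)`, of size at most `3‖Ψ‖/(Nσ)`; squaring
gives the `9`. -/
theorem defect_limit_le (hN : N ≠ 0) (hc : 0 < σc) (hs : 0 < σs) (h : ‖Ψ‖ ≤ 1 / 2)
    (hS : IsInverse Ψ S) (D : Set (Space N)) :
    ∫ x in S ⁻¹' Metric.ball 0 1, twoPhase σc σs D x *
        ‖dualField σc σs D x +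
          (N * twoPhase σc σs D x)⁻¹ • (fderiv ℝ S x).adjoint (S x)‖ ^ 2 ≤
      9 / (N ^ 2 * min σc σs) * volume.real (Metric.ball (0 : Space N) 2) * ‖Ψ‖ ^ 2 := by
  have hΩ2 : S ⁻¹' Metric.ball 0 1 ⊆ Metric.ball (0 : Space N) 2 :=
    (hS.preimage_ball_subset 1).trans (Metric.ball_subset_ball (by linarith))
  have hfin : volume (Metric.ball (0 : Space N) 2) < ⊤ := measure_ball_lt_top
  have hm : 0 < min σc σs := lt_min hc hs
  have hN' : (0 : ℝ) < N := by positivity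
  have key : ∀ x ∈ S ⁻¹' Metric.ball 0 1, ‖twoPhase σc σs D x * ‖dualField σc σs D x +
      (N * twoPhase σc σs D x)⁻¹ • (fderiv ℝ S x).adjoint (S x)‖ ^ 2‖ ≤
      9 / (N ^ 2 * min σc σs) * ‖Ψ‖ ^ 2 := by
    intro x hx
    have hσ := twoPhase_pos (D := D) hc hs x
    have h1 := hS.norm_sub_adjoint_le h (mem_ball_zero_iff.1 hx).le
    have e : dualField σc σs D x + (N * twoPhase σc σs D x)⁻¹ • (fderiv ℝ S x).adjoint (S x) =
        -(N * twoPhase σc σs D x)⁻¹ • (x - (fderiv ℝ S x).adjoint (S x)) := by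
      rw [dualField, smul_sub, neg_smul, neg_smul, sub_neg_eq_add]
    rw [e, norm_smul, norm_neg, norm_mul, Real.norm_of_nonneg hσ.le, norm_pow, norm_mul, norm_norm,
      norm_norm, Real.norm_of_nonneg (by positivity)]
    calc _ ≤ twoPhase σc σs D x * ((N * twoPhase σc σs D x)⁻¹ * (3 * ‖Ψ‖)) ^ 2 := by gcongr
      _ = 9 / (N ^ 2 * twoPhase σc σs D x) * ‖Ψ‖ ^ 2 := by field_simp; ring
      _ ≤ _ := by gcongr; exact min_le_twoPhase x
  refine (le_abs_self _).trans ((norm_setIntegral_le_of_norm_le_const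
    ((measure_mono hΩ2).trans_lt hfin) key).trans ?_)
  have : volume.real (S ⁻¹' Metric.ball 0 1) ≤ volume.real (Metric.ball (0 : Space N) 2) :=
    measureReal_mono hΩ2 hfin.ne
  calc _ ≤ 9 / (N ^ 2 * min σc σs) * ‖Ψ‖ ^ 2 * volume.real (Metric.ball (0 : Space N) 2) := by
        gcongr
    _ = _ := by ring

theorem wellPosed_preimage_ball (hN : N ≠ 0) (hc : 0 < σc) (hs : 0 < σs) (h : ‖Ψ‖ ≤ 1 / 2)
    (hS : IsInverse Ψ S) :
    WellPosed σc σs (S ⁻¹' Metric.ball 0 R) (S ⁻¹' Metric.ball 0 1) := by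
  have := hS.isFiniteMeasure_restrict 1
  exact wellPosed hN hc hs (hS.measurableSet_preimage_ball R) (hS.measurableSet_preimage_ball 1)
    zero_le_two (hS.norm_le_two h)

theorem abs_torsionalRigidity_sub_le (hN : N ≠ 0) (hR : 0 < R) (hc : 0 < σc) (hs : 0 < σs)
    (h : ‖Ψ‖ ≤ 1 / 2) (hS : IsInverse Ψ S) {D : Set (Space N)}
    (hD : D = S ⁻¹' Metric.ball 0 R) :
    |torsionalRigidity σc σs D (S ⁻¹' Metric.ball 0 1) -
      ∫ x in S ⁻¹' Metric.ball 0 1, twoPhase σc σs D x * ‖dualField σc σs D x‖ ^ 2| ≤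
      9 / (N ^ 2 * min σc σs) * volume.real (Metric.ball (0 : Space N) 2) * ‖Ψ‖ ^ 2 := by
  have hDm : MeasurableSet D := hD ▸ hS.measurableSet_preimage_ball R
  have hΩm := hS.measurableSet_preimage_ball 1
  have := hS.isFiniteMeasure_restrict 1
  have hw : WellPosed σc σs D (S ⁻¹' Metric.ball 0 1) := hD ▸ wellPosed_preimage_ball hN hc hs h hS
  obtain ⟨u, g, hu, e⟩ := exists_torsionalRigidity_eq hw
  have h1 := hu.energy_le hN hc hs hDm hΩm (hS.norm_le_two h)
  have h2 : ∀ n, _ := fun n => hu.le_energy hN hc hs hDm hΩm (hS.norm_le_two h)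
    (MemH10.of_contDiff (Metric.isOpen_ball.preimage hS.contDiff.continuous)
      (contDiff_competitor (σc := σc) (σs := σs) (R := R) hS n)
      (hasCompactSupport_competitor hS n) (tsupport_competitor_subset_preimage_ball hS n))
  -- Dirichlet's bound holds for every competitor, hence for the limit of the defects.
  have h3 := le_of_tendsto' ((tendsto_defect hN hR hc hs h hS hD).const_sub _) h2
  have h4 := defect_limit_le hN hc hs h hS D
  rw [e, abs_le]
  have h5 : 0 ≤ 9 / (N ^ 2 * min σc σs) * volume.real (Metric.ball (0 : Space N) 2) * ‖Ψ‖ ^ 2 := by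
    have hm : 0 < min σc σs := lt_min hc hs
    positivity
  constructor <;> linarith

end Defect

/-! ### The dual energy of nearly spherical sets -/

section DualEnergy

variable {N : ℕ} {σc σs : ℝ}

/-- The left side is `|x|²/(N²σ)`, and `σ⁻¹` is `σs⁻¹` plus a jump on `D`. The dual energy thus
depends on the sets only through second moments. -/
theorem twoPhase_mul_norm_dualField_sq (hc : 0 < σc) (hs : 0 < σs) (D : Set (Space N))
    (x : Space N) : twoPhase σc σs D x * ‖dualField σc σs D x‖ ^ 2 =
      (N : ℝ)⁻¹ ^ 2 * σs⁻¹ * ‖x‖ ^ 2 +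
        (N : ℝ)⁻¹ ^ 2 * (σc⁻¹ - σs⁻¹) * D.indicator (fun x => ‖x‖ ^ 2) x := by
  rw [dualField, norm_smul, norm_neg, norm_inv, norm_mul, Real.norm_natCast,
    Real.norm_of_nonneg (twoPhase_pos hc hs x).le, mul_pow, mul_inv, mul_pow]
  by_cases hx : x ∈ D
  · rw [Set.indicator_of_mem hx, twoPhase, if_pos hx]
    field_simp
    ring
  · rw [Set.indicator_of_notMem hx, twoPhase, if_neg hx]
    field_simp
    ring

theorem integrableOn_norm_sq {W : Set (Space N)} {ρ : ℝ} (hW : W ⊆ Metric.ball 0 ρ) :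
    IntegrableOn (fun x : Space N => ‖x‖ ^ 2) W :=
  ((continuous_norm.pow 2).continuousOn.integrableOn_compact (isCompact_closedBall 0 ρ)).mono_set
    (hW.trans Metric.ball_subset_closedBall)

theorem integral_twoPhase_mul_norm_dualField_sq (hc : 0 < σc) (hs : 0 < σs) {D Ω : Set (Space N)}
    (hD : MeasurableSet D) (hDΩ : D ⊆ Ω) {ρ : ℝ} (hΩ : Ω ⊆ Metric.ball 0 ρ) :
    ∫ x in Ω, twoPhase σc σs D x * ‖dualField σc σs D x‖ ^ 2 =
      (N : ℝ)⁻¹ ^ 2 * σs⁻¹ * (∫ x in Ω, ‖x‖ ^ 2) +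
        (N : ℝ)⁻¹ ^ 2 * (σc⁻¹ - σs⁻¹) * ∫ x in D, ‖x‖ ^ 2 := by
  simp only [twoPhase_mul_norm_dualField_sq hc hs]
  have hi := integrableOn_norm_sq hΩ
  rw [integral_add (hi.const_mul _) ((hi.indicator hD).const_mul _), integral_const_mul,
    integral_const_mul, setIntegral_indicator hD, Set.inter_eq_right.2 hDΩ]

/-- Equal volumes allow subtracting `r²` from the integrand, which is then at most `k (2r + k)`
outside the inner ball. `W` and the ball are each compared with the same integral over the inner
ball, hence the factor `2`. -/
theorem abs_setIntegral_norm_sq_sub_le {r k : ℝ} (hk : 0 ≤ k) (hr : 0 ≤ r)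
    {W : Set (Space N)} (hWm : MeasurableSet W)
    (h1 : Metric.ball 0 (r - k) ⊆ W) (h2 : W ⊆ Metric.ball 0 (r + k))
    (hvol : volume W = volume (Metric.ball (0 : Space N) r)) :
    |(∫ x in W, ‖x‖ ^ 2) - ∫ x in Metric.ball (0 : Space N) r, ‖x‖ ^ 2| ≤
      2 * (k * (2 * r + k)) * (volume.real (Metric.ball (0 : Space N) (r + k)) -
        volume.real (Metric.ball (0 : Space N) (r - k))) := by
  have hfin : ∀ s, volume (Metric.ball (0 : Space N) s) < ⊤ := fun s => measure_ball_lt_top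
  have key : ∀ V : Set (Space N), MeasurableSet V → Metric.ball 0 (r - k) ⊆ V →
      V ⊆ Metric.ball 0 (r + k) →
      |(∫ x in V, ‖x‖ ^ 2) - r ^ 2 * volume.real V -
        ∫ x in Metric.ball (0 : Space N) (r - k), (‖x‖ ^ 2 - r ^ 2)| ≤
      k * (2 * r + k) * (volume.real (Metric.ball (0 : Space N) (r + k)) -
        volume.real (Metric.ball (0 : Space N) (r - k))) := by
    intro V hV hV1 hV2
    have hVfin : volume V < ⊤ := (measure_mono hV2).trans_lt (hfin _)
    have hi := integrableOn_norm_sq hV2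
    have hi' : IntegrableOn (fun x : Space N => ‖x‖ ^ 2 - r ^ 2) V :=
      hi.sub (integrableOn_const hVfin.ne)
    have e1 : (∫ x in V, ‖x‖ ^ 2) - r ^ 2 * volume.real V = ∫ x in V, (‖x‖ ^ 2 - r ^ 2) := by
      rw [integral_sub hi (integrableOn_const hVfin.ne), setIntegral_const, smul_eq_mul, mul_comm]
    rw [e1, ← setIntegral_sdiff measurableSet_ball hi' hV1]
    have hb : ∀ x ∈ V \ Metric.ball 0 (r - k), ‖‖x‖ ^ 2 - r ^ 2‖ ≤ k * (2 * r + k) := by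
      rintro x ⟨hx, hx'⟩
      have a1 := mem_ball_zero_iff.1 (hV2 hx)
      rw [mem_ball_zero_iff, not_lt] at hx'
      have a2 := norm_nonneg x
      rw [Real.norm_eq_abs, sq_sub_sq, abs_mul, mul_comm,
        abs_of_nonneg (show 0 ≤ ‖x‖ + r by linarith)]
      have a3 : |‖x‖ - r| ≤ k := by
        rw [abs_le]
        constructor <;> linarith
      have a4 : ‖x‖ + r ≤ 2 * r + k := by linarith
      exact mul_le_mul a3 a4 (by linarith) hk
    refine (norm_setIntegral_le_of_norm_le_const
      ((measure_mono Set.sdiff_subset).trans_lt hVfin) hb).trans ?_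
    rw [measureReal_sdiff hV1 measurableSet_ball hVfin.ne]
    have hmono : volume.real V ≤ volume.real (Metric.ball (0 : Space N) (r + k)) :=
      measureReal_mono hV2 (hfin _).ne
    gcongr
  have k1 := key W hWm h1 h2
  have k2 := key (Metric.ball 0 r) measurableSet_ball (Metric.ball_subset_ball (by linarith))
    (Metric.ball_subset_ball (by linarith))
  have hvr : volume.real W = volume.real (Metric.ball (0 : Space N) r) := by
    rw [measureReal_def, hvol, measureReal_def]
  rw [hvr] at k1
  rw [abs_le] at k1 k2 ⊢
  constructor <;> linarith [k1.1, k1.2, k2.1, k2.2]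

/-- The volume of the annulus of radii `r - k` and `r + k`. -/
def annulusVolume (N : ℕ) (r k : ℝ) : ℝ :=
  volume.real (Metric.ball (0 : Space N) (r + k)) - volume.real (Metric.ball (0 : Space N) (r - k))

theorem tendsto_annulusVolume {r : ℝ} (hr : 0 < r) :
    Tendsto (annulusVolume N r) (𝓝 0) (𝓝 0) := by
  have e : ∀ s : ℝ, 0 < s → volume.real (Metric.ball (0 : Space N) s) =
      s ^ N * volume.real (Metric.ball (0 : Space N) 1) := by
    intro s hs
    rw [measureReal_def, Measure.addHaar_ball_of_pos _ _ hs, ENNReal.toReal_mul,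
      ENNReal.toReal_ofReal (by positivity), finrank_euclideanSpace_fin, measureReal_def]
  have l : Tendsto (fun k : ℝ => (r + k) ^ N * volume.real (Metric.ball (0 : Space N) 1) -
      (r - k) ^ N * volume.real (Metric.ball (0 : Space N) 1)) (𝓝 0) (𝓝 0) := by
    have : Continuous fun k : ℝ => (r + k) ^ N * volume.real (Metric.ball (0 : Space N) 1) -
      (r - k) ^ N * volume.real (Metric.ball (0 : Space N) 1) := by fun_prop
    simpa using this.tendsto 0
  refine l.congr' ?_
  filter_upwards [Ioo_mem_nhds (neg_lt_zero.2 hr) hr] with k hk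
  rw [annulusVolume, e (r + k) (by linarith [hk.1]), e (r - k) (by linarith [hk.2])]

end DualEnergy

/-! ### First-order stationarity under the volume constraints. -/

section Criticality

variable {N : ℕ} {σc σs R : ℝ} {Ψ : C2Bounded (Space N)} {S : Space N → Space N}

theorem IsInverse.zero : IsInverse (0 : C2Bounded (Space N)) id where
  contDiff := contDiff_id
  right_inv x := add_zero x
  left_inv x := add_zero x

/-- The dual energy of perturbed balls of unchanged volumes. -/
theorem abs_dualEnergy_sub_le (hR : 0 < R) (hR1 : R < 1) (hc : 0 < σc) (hs : 0 < σs)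
    (hS : IsInverse Ψ S)
    (hvD : volume (S ⁻¹' Metric.ball 0 R) = volume (Metric.ball (0 : Space N) R))
    (hvΩ : volume (S ⁻¹' Metric.ball 0 1) = volume (Metric.ball (0 : Space N) 1)) :
    |(∫ x in S ⁻¹' Metric.ball 0 1, twoPhase σc σs (S ⁻¹' Metric.ball 0 R) x *
        ‖dualField σc σs (S ⁻¹' Metric.ball 0 R) x‖ ^ 2) -
      ∫ x in Metric.ball 0 1, twoPhase σc σs (Metric.ball (0 : Space N) R) x *
        ‖dualField σc σs (Metric.ball 0 R) x‖ ^ 2| ≤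
      ‖Ψ‖ * ((N : ℝ)⁻¹ ^ 2 * σs⁻¹ * (2 * (2 + ‖Ψ‖) * annulusVolume N 1 ‖Ψ‖) +
        (N : ℝ)⁻¹ ^ 2 * |σc⁻¹ - σs⁻¹| * (2 * (2 * R + ‖Ψ‖) * annulusVolume N R ‖Ψ‖)) := by
  have hsub : Metric.ball (0 : Space N) R ⊆ Metric.ball 0 1 := Metric.ball_subset_ball hR1.le
  rw [integral_twoPhase_mul_norm_dualField_sq hc hs (hS.measurableSet_preimage_ball R)
      (Set.preimage_mono hsub) (hS.preimage_ball_subset 1),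
    integral_twoPhase_mul_norm_dualField_sq hc hs measurableSet_ball hsub subset_rfl]
  have h1 := abs_setIntegral_norm_sq_sub_le (norm_nonneg Ψ) zero_le_one
    (hS.measurableSet_preimage_ball 1) (hS.ball_subset_preimage 1) (hS.preimage_ball_subset 1) hvΩ
  have h2 := abs_setIntegral_norm_sq_sub_le (norm_nonneg Ψ) hR.le
    (hS.measurableSet_preimage_ball R) (hS.ball_subset_preimage R) (hS.preimage_ball_subset R) hvD
  rw [add_sub_add_comm, ← mul_sub, ← mul_sub]
  refine (abs_add_le _ _).trans ?_
  rw [abs_mul, abs_mul ((N : ℝ)⁻¹ ^ 2 * (σc⁻¹ - σs⁻¹)), abs_mul ((N : ℝ)⁻¹ ^ 2) (σc⁻¹ - σs⁻¹),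
    abs_of_nonneg (show 0 ≤ (N : ℝ)⁻¹ ^ 2 * σs⁻¹ by positivity),
    abs_of_nonneg (show 0 ≤ (N : ℝ)⁻¹ ^ 2 by positivity)]
  refine (add_le_add (mul_le_mul_of_nonneg_left h1 (by positivity))
    (mul_le_mul_of_nonneg_left h2 (by positivity))).trans (le_of_eq ?_)
  rw [annulusVolume, annulusVolume]
  ring

theorem abs_torsionalRigidity_sub_ball_le (hN : N ≠ 0) (hR : 0 < R) (hR1 : R < 1) (hc : 0 < σc)
    (hs : 0 < σs) (h : ‖Ψ‖ ≤ 1 / 2) (hS : IsInverse Ψ S)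
    (hvD : volume (S ⁻¹' Metric.ball 0 R) = volume (Metric.ball (0 : Space N) R))
    (hvΩ : volume (S ⁻¹' Metric.ball 0 1) = volume (Metric.ball (0 : Space N) 1)) :
    |torsionalRigidity σc σs (S ⁻¹' Metric.ball 0 R) (S ⁻¹' Metric.ball 0 1) -
      torsionalRigidity σc σs (Metric.ball (0 : Space N) R) (Metric.ball 0 1)| ≤
      ‖Ψ‖ * (9 / (N ^ 2 * min σc σs) * volume.real (Metric.ball (0 : Space N) 2) * ‖Ψ‖ +
        ((N : ℝ)⁻¹ ^ 2 * σs⁻¹ * (2 * (2 + ‖Ψ‖) * annulusVolume N 1 ‖Ψ‖) +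
        (N : ℝ)⁻¹ ^ 2 * |σc⁻¹ - σs⁻¹| * (2 * (2 * R + ‖Ψ‖) * annulusVolume N R ‖Ψ‖))) := by
  have h1 := abs_torsionalRigidity_sub_le hN hR hc hs h hS rfl
  -- For `Ψ = 0` the error bound is zero: on the concentric balls the energy equals the dual energy
  -- exactly.
  have h0 := abs_torsionalRigidity_sub_le (N := N) (σc := σc) (σs := σs) hN hR hc hs
    (Ψ := 0) (by simp) IsInverse.zero (D := Metric.ball 0 R) rfl
  have h2 := abs_dualEnergy_sub_le hR hR1 hc hs hS hvD hvΩ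
  rw [norm_zero, Set.preimage_id] at h0
  rw [abs_le] at h0 h1 h2 ⊢
  constructor <;> linarith [h0.1, h0.2, h1.1, h1.2, h2.1, h2.2]

/-- `κ` is `O(t - a)` and `ω` is `o(1)`, so the increment is `o(t - a)`. -/
theorem HasDerivWithinAt.zero_of_abs_sub_le {f κ ω : ℝ → ℝ} {s : Set ℝ} {a : ℝ}
    (hκ : κ =O[𝓝[s] a] fun t => t - a) (hω : Tendsto ω (𝓝[s] a) (𝓝 0))
    (h : ∀ᶠ t in 𝓝[s] a, |f t - f a| ≤ κ t * ω t) : HasDerivWithinAt f 0 s a := by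
  rw [hasDerivWithinAt_iff_isLittleO]
  have h1 : (fun t => f t - f a - (t - a) • (0 : ℝ)) =O[𝓝[s] a] fun t => κ t * ω t := by
    refine Asymptotics.IsBigO.of_bound 1 ?_
    filter_upwards [h] with t ht
    rw [smul_zero, sub_zero, one_mul, Real.norm_eq_abs]
    exact ht.trans (le_abs_self _)
  refine h1.trans_isLittleO ?_
  simpa using hκ.mul_isLittleO ((Asymptotics.isLittleO_one_iff ℝ).2 hω)

end Criticality

end

theorem theorem1 (N : ℕ) (hN : 2 ≤ N) (R : ℝ) (hR0 : 0 < R) (hR1 : R < 1)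
    (σc σs : ℝ) (hc : 0 < σc) (hs : 0 < σs)
    (Φ : ℝ → C2Bounded (Space N)) (hΦ : IsPerturbation Φ)
    (hD : PreservesVolume Φ (Metric.ball (0 : Space N) R))
    (hΩ : PreservesVolume Φ (Metric.ball (0 : Space N) 1)) :
    (∀ᶠ t in 𝓝[≥] (0 : ℝ), WellPosed σc σs (perturbed Φ (Metric.ball (0 : Space N) R) t)
      (perturbed Φ (Metric.ball (0 : Space N) 1) t)) ∧
    HasShapeDeriv (torsionalRigidity σc σs) (Metric.ball (0 : Space N) R)
      (Metric.ball (0 : Space N) 1) Φ 0 := by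
  have hN0 : N ≠ 0 := by omega
  obtain ⟨hΦ0, hΦd⟩ := hΦ
  -- Reconciles the filter of the one-sided derivative with that of the volume hypotheses.
  have hnhds : 𝓝[Set.Ico 0 1] (0 : ℝ) = 𝓝[≥] 0 := nhdsWithin_Ico_eq_nhdsGE zero_lt_one
  -- Differentiability at `0` enters only through `‖Φ t‖ = O(t)`.
  have hκ : (fun t => ‖Φ t‖) =O[𝓝[Set.Ico 0 1] (0 : ℝ)] fun t => t - 0 := by
    have := hΦd.isBigO_sub
    simp only [hΦ0, sub_zero] at this ⊢
    exact this.norm_left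
  have hlim : Tendsto (fun t => ‖Φ t‖) (𝓝[Set.Ico 0 1] (0 : ℝ)) (𝓝 0) := by
    have := hΦd.continuousWithinAt.norm
    rwa [ContinuousWithinAt, hΦ0, norm_zero] at this
  have hsmall : ∀ᶠ t in 𝓝[Set.Ico 0 1] (0 : ℝ), ‖Φ t‖ ≤ 1 / 2 :=
    (hlim.eventually_lt_const (by norm_num : (0 : ℝ) < 1 / 2)).mono fun t ht => ht.le
  refine ⟨?_, ?_⟩
  · rw [← hnhds]
    filter_upwards [hsmall] with t ht
    obtain ⟨S, hS⟩ := exists_isInverse (Φ t) ht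
    rw [perturbed, perturbed, hS.image_eq_preimage, hS.image_eq_preimage]
    exact wellPosed_preimage_ball hN0 hc hs ht hS
  · unfold PreservesVolume at hD hΩ
    rw [← hnhds] at hD hΩ
    have hzero : ∀ ω : Set (Space N), perturbed Φ ω 0 = ω := by
      intro ω
      have := (IsInverse.zero (N := N)).image_eq_preimage ω
      rwa [← hΦ0] at this
    refine HasDerivWithinAt.zero_of_abs_sub_le (κ := fun t => ‖Φ t‖)
      (ω := fun t =>
        9 / (N ^ 2 * min σc σs) * volume.real (Metric.ball (0 : Space N) 2) * ‖Φ t‖ +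
        ((N : ℝ)⁻¹ ^ 2 * σs⁻¹ * (2 * (2 + ‖Φ t‖) * annulusVolume N 1 ‖Φ t‖) +
        (N : ℝ)⁻¹ ^ 2 * |σc⁻¹ - σs⁻¹| * (2 * (2 * R + ‖Φ t‖) * annulusVolume N R ‖Φ t‖)))
      hκ ?_ ?_
    · have l1 := (tendsto_annulusVolume (N := N) zero_lt_one).comp hlim
      have l2 := (tendsto_annulusVolume (N := N) hR0).comp hlim
      have l := (hlim.const_mul
        (9 / (N ^ 2 * min σc σs) * volume.real (Metric.ball (0 : Space N) 2))).add
        (((((hlim.const_add 2).const_mul 2).mul l1).const_mul ((N : ℝ)⁻¹ ^ 2 * σs⁻¹)).add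
        ((((hlim.const_add (2 * R)).const_mul 2).mul l2).const_mul
          ((N : ℝ)⁻¹ ^ 2 * |σc⁻¹ - σs⁻¹|)))
      simpa only [mul_zero, add_zero, Function.comp_apply] using l
    · filter_upwards [hsmall, hD, hΩ] with t ht hDt hΩt
      obtain ⟨S, hS⟩ := exists_isInverse (Φ t) ht
      rw [hzero, hzero]
      rw [perturbed, hS.image_eq_preimage] at hDt hΩt
      rw [perturbed, perturbed, hS.image_eq_preimage, hS.image_eq_preimage]
      exact abs_torsionalRigidity_sub_ball_le hN0 hR0 hR1 hc hs ht hS hDt hΩt
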